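/- Conventions. The language of groups has a binary operation, a unary inverse and a constant for the identity. For a structure $\mathcal{B}$ in this language with universe $\subseteq\mathbb{N}$, $D(\mathcal{B})$ is the set of Gödel numbers of its true atomic and negated atomic sentences (with constants for the elements of $\mathcal{B}$). $\mathcal{B}$ is computable if $D(\mathcal{B})$ is computable, and an abstract structure is called computable if it is isomorphic to such a $\mathcal{B}$. The index set of $\mathcal{A}$ is $I(\mathcal{A})=\{e\in\mathbb{N}:\varphi_e=\chi_{D(\mathcal{B})}\text{ for some }\mathcal{B}\cong\mathcal{A}\}$, where $\varphi_e$ is the $e$-th partial computable function. Computable $\Sigma_0$ and $\Pi_0$ formulas are the finitary quantifier-free formulas; for $n>0$, a computable $\Sigma_n$ (resp. $\Pi_n$) formula is a c.e. disjunction of formulas $(\exists\bar y)\psi$ (resp. a c.e. conjunction of formulas $(\forall\bar y)\psi$) with each $\psi$ computable $\Pi_m$ (resp. $\Sigma_m$) for some $m<n$. A formula is computable $d$-$\Sigma_2$ if it is the conjunction of a computable $\Sigma_2$ formula and a computable $\Pi_2$ formula. A Scott sentence for $\mathcal{A}$ is a sentence of $L_{\omega_1\omega}$ whose countable models are exactly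 the isomorphic copies of $\mathcal{A}$. A set $S\subseteq\mathbb{N}$ is $d$-$\Sigma^0_2$ if $S=S_1\setminus S_2$ with $S_1,S_2$ both $\Sigma^0_2$; it is $m$-complete $d$-$\Sigma^0_2$ if moreover every $d$-$\Sigma^0_2$ set is many-one reducible to it. Theorem. Let $G$ be a computable subgroup of the additive group $\mathbb{Q}$, and fix a nonzero element $u\in G$ to play the role of $1$. Let $P$ be the set of primes, and let $$P^0=\{p\in P: p\nmid u\text{ in }G\},$$ $$P^{fin}=\{p\in P: p^k\mid u\text{ and }p^{k+1}\nmid u\text{ in }G\text{ for some }k>0\},$$ $$P^\infty=\{p\in P: p^k\mid u\text{ in }G\text{ for all }k>0\},$$ where $n\mid u$ in $G$ means $u=ny$ for some $y\in G$. Suppose that $P^0$ and $P^{fin}$ are finite, and that $P^\infty$ is infinite but $P^\infty\neq P$. Then $G$ has a computable $d$-$\Sigma_2$ Scott sentence, and $I(G)$ is $m$-complete $d$-$\Sigma^0_2$. -/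

import Mathlib

/-! ## The language of groups -/

/-- Function symbols of the language of groups: a constant for the identity, a unary symbol for the
inverse and a binary symbol for the group operation. -/
inductive GrpFunc : ℕ → Type
  | e : GrpFunc 0
  | inv : GrpFunc 1
  | op : GrpFunc 2

/-- The language of groups (no relation symbols besides equality). -/
def grpLang : FirstOrder.Language := ⟨GrpFunc, fun _ => Empty⟩

/-- A subgroup of the additive group of rationals, as a structure for the language of groups. -/
instance AddSubgroup.grpStructure (G : AddSubgroup ℚ) : grpLang.Structure G where
  funMap {_} f x :=
    match f, x with
    | GrpFunc.e, _ => 0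
    | GrpFunc.inv, x => -(x 0)
    | GrpFunc.op, x => x 0 + x 1
  RelMap r _ := Empty.elim r

/-- The Gödel number of a term, given numbers `c a` for its variables (or constants) `a`. -/
def termCode {α : Type} (c : α → ℕ) : grpLang.Term α → ℕ
  | .var a => 3 * c a + 1
  | .func GrpFunc.e _ => 0
  | .func GrpFunc.inv ts => 3 * termCode c (ts 0) + 2
  | .func GrpFunc.op ts => 3 * Nat.pair (termCode c (ts 0)) (termCode c (ts 1)) + 3

/-- Finitary quantifier-free formulas in normal form (negations only next to atomic formulas). -/
inductive QF (α : Type) : Type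
  | eq (s t : grpLang.Term α) : QF α
  | ne (s t : grpLang.Term α) : QF α
  | and (φ ψ : QF α) : QF α
  | or (φ ψ : QF α) : QF α

namespace QF

/-- Truth of a quantifier-free formula under an assignment. -/
def Realize {α : Type} {M : Type*} [grpLang.Structure M] (v : α → M) : QF α → Prop
  | eq s t => s.realize v = t.realize v
  | ne s t => s.realize v ≠ t.realize v
  | and φ ψ => Realize v φ ∧ Realize v ψ
  | or φ ψ => Realize v φ ∨ Realize v ψ

/-- The Gödel number of a quantifier-free formula. -/
def code {α : Type} (c : α → ℕ) : QF α → ℕ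
  | eq s t => 4 * Nat.pair (termCode c s) (termCode c t)
  | ne s t => 4 * Nat.pair (termCode c s) (termCode c t) + 1
  | and φ ψ => 4 * Nat.pair (code c φ) (code c ψ) + 2
  | or φ ψ => 4 * Nat.pair (code c φ) (code c ψ) + 3

end QF

/-- Distinct terms have distinct Gödel numbers. -/
theorem termCode_injective {α : Type} {c : α → ℕ} (hc : Function.Injective c) :
    Function.Injective (termCode c) := by
  intro s
  induction s with
  | var a =>
    intro t h
    match t, h with
    | .var b, h => simp only [termCode] at h; rw [hc (by omega : c a = c b)]
    | .func GrpFunc.e _, h => simp only [termCode] at h; omega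
    | .func GrpFunc.inv _, h => simp only [termCode] at h; omega
    | .func GrpFunc.op _, h => simp only [termCode] at h; omega
  | func f ts ih =>
    intro t h
    match f, ts, ih, t, h with
    | GrpFunc.e, ts, _, .func GrpFunc.e us, _ =>
      congr 1
      funext i
      exact i.elim0
    | GrpFunc.e, _, _, .var _, h => simp only [termCode] at h; omega
    | GrpFunc.e, _, _, .func GrpFunc.inv _, h => simp only [termCode] at h; omega
    | GrpFunc.e, _, _, .func GrpFunc.op _, h => simp only [termCode] at h; omega
    | GrpFunc.inv, ts, ih, .func GrpFunc.inv us, h =>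
      simp only [termCode] at h
      have h0 : ts 0 = us 0 := ih 0 (by omega)
      congr 1
      funext i
      fin_cases i
      exact h0
    | GrpFunc.inv, _, _, .var _, h => simp only [termCode] at h; omega
    | GrpFunc.inv, _, _, .func GrpFunc.e _, h => simp only [termCode] at h; omega
    | GrpFunc.inv, _, _, .func GrpFunc.op _, h => simp only [termCode] at h; omega
    | GrpFunc.op, ts, ih, .func GrpFunc.op us, h =>
      simp only [termCode, Nat.add_right_cancel_iff] at h
      have h' := Nat.pair_eq_pair.1 (Nat.eq_of_mul_eq_mul_left (by norm_num) h)
      have h0 : ts 0 = us 0 := ih 0 h'.1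
      have h1 : ts 1 = us 1 := ih 1 h'.2
      congr 1
      funext i
      fin_cases i
      · exact h0
      · exact h1
    | GrpFunc.op, _, _, .var _, h => simp only [termCode] at h; omega
    | GrpFunc.op, _, _, .func GrpFunc.e _, h => simp only [termCode] at h; omega
    | GrpFunc.op, _, _, .func GrpFunc.inv _, h => simp only [termCode] at h; omega

/-! ## Partial computable functions, arithmetical complexity -/

/-- The `e`-th partial computable function. -/
def phi (e : ℕ) : ℕ →. ℕ := (Denumerable.ofNat Nat.Partrec.Code e).eval

/-- The `e`-th computably enumerable set. -/
def ceSet (e : ℕ) : Set ℕ := {n | (phi e n).Dom}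

/-- `S` is `Σ⁰₂`: membership has the form `∃ x, ∀ y, R n x y` with `R` computable. -/
def IsSigma02 (S : Set ℕ) : Prop :=
  ∃ R : ℕ × ℕ × ℕ → Prop, ComputablePred R ∧ ∀ n, n ∈ S ↔ ∃ x, ∀ y, R (n, x, y)

/-- `S` is `d-Σ⁰₂`: a difference of two `Σ⁰₂` sets. -/
def IsDSigma02 (S : Set ℕ) : Prop :=
  ∃ S₁ S₂ : Set ℕ, IsSigma02 S₁ ∧ IsSigma02 S₂ ∧ S = S₁ \ S₂

/-- `I` is `m`-complete for the class `Γ` of sets of natural numbers. -/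
def IsMComplete (Γ : Set ℕ → Prop) (I : Set ℕ) : Prop :=
  Γ I ∧ ∀ S : Set ℕ, Γ S → ManyOneReducible (fun n => n ∈ S) (fun n => n ∈ I)

/-! ## Atomic diagrams, computable structures, index sets -/

/-- The atomic diagram of a structure with universe `A ⊆ ℕ`: the set of Gödel numbers of the atomic
sentences and negated atomic sentences, with the elements of `A` as additional constants,
that are true in the structure. -/
def atomicDiagram (A : Set ℕ) [grpLang.Structure A] : Set ℕ :=
  {n | ∃ s t : grpLang.Term A, ∃ φ : QF A,
    (φ = QF.eq s t ∨ φ = QF.ne s t) ∧ φ.Realize id ∧ n = φ.code Subtype.val}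

/-- The structures `M` and `N` for the language of groups are isomorphic. -/
def GrpIso (M N : Type*) [grpLang.Structure M] [grpLang.Structure N] : Prop :=
  Nonempty (FirstOrder.Language.Equiv grpLang M N)

/-- `M` is isomorphic to a structure with universe a set of natural numbers and computable atomic
diagram. -/
def HasComputableCopy (M : Type*) [grpLang.Structure M] : Prop :=
  ∃ (A : Set ℕ) (_ : grpLang.Structure A),
    ComputablePred (fun n => n ∈ atomicDiagram A) ∧ GrpIso A M

open Classical in
/-- The index set of `M`: all `e` such that the `e`-th partial computable function is the
characteristic function of the atomic diagram of a structure isomorphic to `M`. -/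
noncomputable def indexSet (M : Type*) [grpLang.Structure M] : Set ℕ :=
  {e | ∃ (A : Set ℕ) (_ : grpLang.Structure A),
    (∀ n, phi e n = Part.some (if n ∈ atomicDiagram A then 1 else 0)) ∧ GrpIso A M}

/-! ## Infinitary formulas -/

/-- Formulas of `L_{ω₁ω}` in normal form, in the free variables `x₀, …, x_{k-1}`:
`disj D m f` is the countable disjunction over `i ∈ D` of the formulas `∃ y₁ … y_{m i}, f i`,
and `conj D m f` is the countable conjunction over `i ∈ D` of the formulas `∀ y₁ … y_{m i}, f i`,
where the new variables are `x_k, …, x_{k + m i - 1}`. -/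
inductive InfFormula : ℕ → Type
  | qf {k : ℕ} (φ : QF (Fin k)) : InfFormula k
  | disj {k : ℕ} (D : Set ℕ) (m : D → ℕ) (f : (i : D) → InfFormula (k + m i)) : InfFormula k
  | conj {k : ℕ} (D : Set ℕ) (m : D → ℕ) (f : (i : D) → InfFormula (k + m i)) : InfFormula k

namespace InfFormula

/-- Satisfaction of an infinitary formula. -/
def Realize {M : Type*} [grpLang.Structure M] : {k : ℕ} → InfFormula k → (Fin k → M) → Prop
  | _, qf φ, v => φ.Realize v
  | _, disj D m f, v => ∃ i : D, ∃ y : Fin (m i) → M, (f i).Realize (Fin.append v y)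
  | _, conj D m f, v => ∀ i : D, ∀ y : Fin (m i) → M, (f i).Realize (Fin.append v y)

/-- The two kinds of computable infinitary formulas. -/
inductive Kind : Type
  | sigma
  | pi

/-- `φ.HasIndex Kind.sigma n e` (resp. `φ.HasIndex Kind.pi n e`): `φ` is a computable `Σₙ`
(resp. `Πₙ`) formula with index `e`. For `n = 0`, `φ` is finitary quantifier-free with Gödel number
`e`. A computable `Σₙ` formula with `n > 0` is the disjunction over the c.e. set `ceSet e`, where
a member `⟨b, l, d⟩` of this set stands for the disjunct `∃ y₁ … y_l, ψ` with `ψ`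
the computable `Π_b` formula with index `d`, and `b < n`. Dually for `Πₙ`. -/
def HasIndex : {k : ℕ} → InfFormula k → Kind → ℕ → ℕ → Prop
  | _, qf φ, _, n, e => n = 0 ∧ e = φ.code Fin.val
  | _, disj D m f, Kind.sigma, n, e => 0 < n ∧ D = ceSet e ∧ ∀ i : D, ∃ b l d : ℕ,
      i.1 = Nat.pair b (Nat.pair l d) ∧ b < n ∧ m i = l ∧ (f i).HasIndex Kind.pi b d
  | _, conj D m f, Kind.pi, n, e => 0 < n ∧ D = ceSet e ∧ ∀ i : D, ∃ b l d : ℕ,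
      i.1 = Nat.pair b (Nat.pair l d) ∧ b < n ∧ m i = l ∧ (f i).HasIndex Kind.sigma b d
  | _, disj _ _ _, Kind.pi, _, _ => False
  | _, conj _ _ _, Kind.sigma, _, _ => False

/-- `φ` is a computable `Σₙ` formula. -/
def IsComputableSigma {k : ℕ} (n : ℕ) (φ : InfFormula k) : Prop := ∃ e, φ.HasIndex Kind.sigma n e

/-- `φ` is a computable `Πₙ` formula. -/
def IsComputablePi {k : ℕ} (n : ℕ) (φ : InfFormula k) : Prop := ∃ e, φ.HasIndex Kind.pi n e

/-- The conjunction of two formulas. -/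
def inf {k : ℕ} (φ ψ : InfFormula k) : InfFormula k :=
  conj {i | i < 2} (fun _ => 0) (fun i => if i.1 = 0 then φ else ψ)

theorem realize_inf {M : Type*} [grpLang.Structure M] {k : ℕ} (φ ψ : InfFormula k)
    (v : Fin k → M) : (φ.inf ψ).Realize v ↔ φ.Realize v ∧ ψ.Realize v := by
  have hv : ∀ y : Fin 0 → M, (Fin.append v y : Fin (k + 0) → M) = v := fun y => by
    rw [Subsingleton.elim y Fin.elim0, Fin.append_elim0]
    rfl
  simp only [inf, Realize]
  constructor
  · intro h
    have h0 := h ⟨0, by simp⟩ Fin.elim0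
    have h1 := h ⟨1, by simp⟩ Fin.elim0
    rw [hv] at h0 h1
    exact ⟨by simpa using h0, by simpa using h1⟩
  · rintro ⟨h0, h1⟩ i y
    rw [hv]
    by_cases hi : i.1 = 0
    · simpa [hi] using h0
    · simpa [hi] using h1

/-- `φ` is computable `d-Σ₂`: the conjunction of a computable `Σ₂` formula and a computable
`Π₂` formula. -/
def IsComputableDSigma2 {k : ℕ} (φ : InfFormula k) : Prop :=
  ∃ σ π : InfFormula k, σ.IsComputableSigma 2 ∧ π.IsComputablePi 2 ∧ φ = σ.inf π

end InfFormula

/-- The sentence `φ` is a Scott sentence for `M`: its countable models are exactly the isomorphic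
copies of `M`. -/
def IsScottSentence (φ : InfFormula 0) (M : Type*) [grpLang.Structure M] : Prop :=
  ∀ (N : Type) [grpLang.Structure N], Countable N → (φ.Realize (Fin.elim0 : Fin 0 → N) ↔ GrpIso N M)

/-! ## Divisibility by primes in a subgroup of the rationals -/

/-- `n` divides `x` in `G`. -/
def DividesIn {G : AddSubgroup ℚ} (n : ℕ) (x : G) : Prop := ∃ y : G, n • y = x

/-- The primes that do not divide `u` in `G`, where `u` plays the role of `1`. -/
def P0 {G : AddSubgroup ℚ} (u : G) : Set ℕ := {p | p.Prime ∧ ¬ DividesIn p u}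

/-- The primes that divide `u` in `G`, but only finitely often. -/
def PFin {G : AddSubgroup ℚ} (u : G) : Set ℕ :=
  {p | p.Prime ∧ ∃ k > 0, DividesIn (p ^ k) u ∧ ¬ DividesIn (p ^ (k + 1)) u}

/-- The primes that divide `u` in `G` infinitely often. -/
def PInf {G : AddSubgroup ℚ} (u : G) : Set ℕ := {p | p.Prime ∧ ∀ k > 0, DividesIn (p ^ k) u}

/-! ## Automation for computability -/

attribute [fun_prop] Computable Computable.const Computable.comp

namespace Computable

variable {α β γ : Type*} [Primcodable α] [Primcodable β] [Primcodable γ]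

@[fun_prop]
theorem fun_id : Computable fun x : α => x := Computable.id

@[fun_prop]
theorem fun_pair {f : α → β} {g : α → γ} (hf : Computable f) (hg : Computable g) :
    Computable fun x => (f x, g x) := hf.pair hg

@[fun_prop]
theorem fun_fst {f : α → β × γ} (hf : Computable f) : Computable fun x => (f x).1 :=
  Computable.fst.comp hf

@[fun_prop]
theorem fun_snd {f : α → β × γ} (hf : Computable f) : Computable fun x => (f x).2 :=
  Computable.snd.comp hf

@[fun_prop]
theorem fun_add {f g : α → ℕ} (hf : Computable f) (hg : Computable g) :
    Computable fun x => f x + g x := Primrec.nat_add.to_comp.comp hf hg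

@[fun_prop]
theorem fun_sub {f g : α → ℕ} (hf : Computable f) (hg : Computable g) :
    Computable fun x => f x - g x := Primrec.nat_sub.to_comp.comp hf hg

@[fun_prop]
theorem fun_mul {f g : α → ℕ} (hf : Computable f) (hg : Computable g) :
    Computable fun x => f x * g x := Primrec.nat_mul.to_comp.comp hf hg

@[fun_prop]
theorem fun_div {f g : α → ℕ} (hf : Computable f) (hg : Computable g) :
    Computable fun x => f x / g x := Primrec.nat_div.to_comp.comp hf hg

@[fun_prop]
theorem fun_mod {f g : α → ℕ} (hf : Computable f) (hg : Computable g) :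
    Computable fun x => f x % g x := Primrec.nat_mod.to_comp.comp hf hg

@[fun_prop]
theorem fun_natPair {f g : α → ℕ} (hf : Computable f) (hg : Computable g) :
    Computable fun x => Nat.pair (f x) (g x) := Primrec₂.natPair.to_comp.comp hf hg

@[fun_prop]
theorem fun_unpair {f : α → ℕ} (hf : Computable f) : Computable fun x => Nat.unpair (f x) :=
  Computable.unpair.comp hf

@[fun_prop]
theorem fun_cond {c : α → Bool} {f g : α → β} (hc : Computable c) (hf : Computable f)
    (hg : Computable g) : Computable fun x => bif c x then f x else g x := hc.cond hf hg

@[fun_prop]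
theorem fun_beq [BEq β] [LawfulBEq β] {f g : α → β} (hf : Computable f) (hg : Computable g) :
    Computable fun x => f x == g x := by
  classical
  have h : Computable₂ fun a b : β => decide (a = b) :=
    (primrecRel_iff_primrec_decide.1 Primrec.eq).to_comp
  exact (h.comp hf hg).of_eq fun x => by rw [Bool.eq_iff_iff]; simp

@[fun_prop]
theorem fun_and {f g : α → Bool} (hf : Computable f) (hg : Computable g) :
    Computable fun x => f x && g x := Primrec.and.to_comp.comp hf hg

@[fun_prop]
theorem fun_or {f g : α → Bool} (hf : Computable f) (hg : Computable g) :
    Computable fun x => f x || g x := Primrec.or.to_comp.comp hf hg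

@[fun_prop]
theorem fun_not {f : α → Bool} (hf : Computable f) : Computable fun x => !f x :=
  Primrec.not.to_comp.comp hf

@[fun_prop]
theorem fun_ofNat {β : Type*} [Denumerable β] {f : α → ℕ} (hf : Computable f) :
    Computable fun x => Denumerable.ofNat β (f x) := (Primrec.ofNat β).to_comp.comp hf

@[fun_prop]
theorem fun_natRec {f : α → ℕ} {g : α → β} {h : α × ℕ × β → β} (hf : Computable f)
    (hg : Computable g) (hh : Computable h) :
    Computable fun x => Nat.rec (motive := fun _ => β) (g x) (fun n r => h (x, n, r)) (f x) :=
  Computable.nat_rec hf hg hh.to₂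

end Computable

/-! ## Terms and literals in the language of groups -/

section Terms

variable {α β : Type}

/-- The term for the identity. -/
def tZero : grpLang.Term α := .func GrpFunc.e ![]

/-- The term for the inverse. -/
def tNeg (s : grpLang.Term α) : grpLang.Term α := .func GrpFunc.inv ![s]

/-- The term for the group operation. -/
def tAdd (s t : grpLang.Term α) : grpLang.Term α := .func GrpFunc.op ![s, t]

/-- The term for the `n`-th multiple. -/
def tMul (s : grpLang.Term α) : ℕ → grpLang.Term α
  | 0 => tZero
  | n + 1 => tAdd (tMul s n) s

/-- The literals of the `Π₂` part of the Scott sentence. For the axiom number `j`, one asks that for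
all `n, x, y, z` there are `c, a, m, w` that make the literal true. -/
def lit (M j n c a m : ℕ) (x y z w : α) : QF α :=
  let X := .var x; let Y := .var y; let Z := .var z; let W := .var w
  bif j == 0 then .eq (tAdd X (tAdd Y Z)) (tAdd (tAdd X Y) Z) else
  bif j == 1 then .eq (tAdd X Y) (tAdd Y X) else
  bif j == 2 then .eq (tAdd tZero X) X else
  bif j == 3 then .eq (tAdd (tNeg X) X) tZero else
  bif j == 4 then (bif c == 0 then .ne (tMul X (n + 1)) tZero else .eq X tZero) else
  bif j == 5 then .eq (tMul W (n * M + 1)) X else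
  bif c == 0 then .eq (tMul X (a + 1)) (tMul Y m) else
  bif c == 1 then .eq (tMul X (a + 1)) (tMul (tNeg Y) m) else .eq Y tZero

/-- The literal saying that `x` is not the `p`-th multiple of `y`. -/
def litNe (p : ℕ) (x y : α) : QF α := .ne (tMul (.var y) p) (.var x)

/-- The function on codes that corresponds to `tMul`. -/
def mulCode (s n : ℕ) : ℕ := Nat.rec 0 (fun _ r => 3 * Nat.pair r s + 3) n

@[fun_prop]
theorem Computable.fun_mulCode {α : Type*} [Primcodable α] {f g : α → ℕ} (hf : Computable f)
    (hg : Computable g) : Computable fun x => mulCode (f x) (g x) := by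
  have := Computable.fun_natRec (h := fun p : α × ℕ × ℕ => 3 * Nat.pair p.2.2 (f p.1) + 3)
    hg (Computable.const 0) (by fun_prop)
  exact this

theorem termCode_tZero (c : α → ℕ) : termCode c tZero = 0 := by simp [tZero, termCode]

theorem termCode_tNeg (c : α → ℕ) (s) : termCode c (tNeg s) = 3 * termCode c s + 2 := by
  simp [tNeg, termCode]

theorem termCode_tAdd (c : α → ℕ) (s t) :
    termCode c (tAdd s t) = 3 * Nat.pair (termCode c s) (termCode c t) + 3 := by
  simp [tAdd, termCode]

theorem termCode_tMul (c : α → ℕ) (s n) : termCode c (tMul s n) = mulCode (termCode c s) n := by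
  induction n with
  | zero => exact termCode_tZero c
  | succ n ih => rw [tMul, termCode_tAdd, ih]; rfl

/-- The Gödel number of `lit`. -/
def litCode (M j n c a m x y z w : ℕ) : ℕ :=
  let X := 3 * x + 1; let Y := 3 * y + 1; let Z := 3 * z + 1; let W := 3 * w + 1
  bif j == 0 then 4 * Nat.pair (3 * Nat.pair X (3 * Nat.pair Y Z + 3) + 3)
    (3 * Nat.pair (3 * Nat.pair X Y + 3) Z + 3) else
  bif j == 1 then 4 * Nat.pair (3 * Nat.pair X Y + 3) (3 * Nat.pair Y X + 3) else
  bif j == 2 then 4 * Nat.pair (3 * Nat.pair 0 X + 3) X else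
  bif j == 3 then 4 * Nat.pair (3 * Nat.pair (3 * X + 2) X + 3) 0 else
  bif j == 4 then (bif c == 0 then 4 * Nat.pair (mulCode X (n + 1)) 0 + 1 else 4 * Nat.pair X 0) else
  bif j == 5 then 4 * Nat.pair (mulCode W (n * M + 1)) X else
  bif c == 0 then 4 * Nat.pair (mulCode X (a + 1)) (mulCode Y m) else
  bif c == 1 then 4 * Nat.pair (mulCode X (a + 1)) (mulCode (3 * Y + 2) m) else 4 * Nat.pair Y 0

theorem code_lit (C : α → ℕ) (M j n c a m : ℕ) (x y z w : α) :
    (lit M j n c a m x y z w).code C = litCode M j n c a m (C x) (C y) (C z) (C w) := by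
  simp only [lit, litCode, Bool.apply_cond (QF.code C), QF.code, termCode_tAdd, termCode_tMul,
    termCode_tZero, termCode_tNeg, termCode]

theorem code_litNe (C : α → ℕ) (p : ℕ) (x y : α) :
    (litNe p x y).code C = 4 * Nat.pair (mulCode (3 * C y + 1) p) (3 * C x + 1) + 1 := by
  simp only [litNe, QF.code, termCode_tMul, termCode]

@[fun_prop]
theorem Computable.fun_litCode {α : Type*} [Primcodable α] (M : ℕ)
    {j n c a m x y z w : α → ℕ} (hj : Computable j)
    (hn : Computable n) (hc : Computable c) (ha : Computable a) (hm : Computable m)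
    (hx : Computable x) (hy : Computable y) (hz : Computable z) (hw : Computable w) :
    Computable fun i => litCode M (j i) (n i) (c i) (a i) (m i) (x i) (y i) (z i) (w i) := by
  unfold litCode
  fun_prop

/-! ### Renaming variables -/

/-- Rename the variables of a quantifier-free formula. -/
def QF.map (g : α → β) : QF α → QF β
  | .eq s t => .eq (s.relabel g) (t.relabel g)
  | .ne s t => .ne (s.relabel g) (t.relabel g)
  | .and φ ψ => .and (φ.map g) (ψ.map g)
  | .or φ ψ => .or (φ.map g) (ψ.map g)

theorem QF.realize_map {N : Type} [grpLang.Structure N] (g : α → β) (v : β → N) (φ : QF α) :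
    (φ.map g).Realize v ↔ φ.Realize (v ∘ g) := by
  induction φ with
  | eq s t => simp only [map, Realize, FirstOrder.Language.Term.realize_relabel]
  | ne s t => simp only [map, Realize, FirstOrder.Language.Term.realize_relabel]
  | and φ ψ h h' => simp only [map, Realize, h, h']
  | or φ ψ h h' => simp only [map, Realize, h, h']

theorem relabel_tZero (g : α → β) : (tZero : grpLang.Term α).relabel g = tZero := by
  simp only [tZero, FirstOrder.Language.Term.relabel]; congr 1; funext i; exact i.elim0

theorem relabel_tNeg (g : α → β) (s) : (tNeg s).relabel g = tNeg (s.relabel g) := by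
  simp only [tNeg, FirstOrder.Language.Term.relabel]; congr 1; funext i; fin_cases i; rfl

theorem relabel_tAdd (g : α → β) (s t) :
    (tAdd s t).relabel g = tAdd (s.relabel g) (t.relabel g) := by
  simp only [tAdd, FirstOrder.Language.Term.relabel]; congr 1; funext i; fin_cases i <;> rfl

theorem relabel_tMul (g : α → β) (s) (n : ℕ) : (tMul s n).relabel g = tMul (s.relabel g) n := by
  induction n with
  | zero => exact relabel_tZero g
  | succ n ih => rw [tMul, relabel_tAdd, ih]; rfl

theorem map_lit (g : α → β) (M j n c a m : ℕ) (x y z w : α) :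
    (lit M j n c a m x y z w).map g = lit M j n c a m (g x) (g y) (g z) (g w) := by
  simp only [lit, Bool.apply_cond (QF.map g), QF.map, relabel_tZero, relabel_tNeg, relabel_tAdd,
    relabel_tMul, FirstOrder.Language.Term.relabel]

theorem map_litNe (g : α → β) (p : ℕ) (x y : α) : (litNe p x y).map g = litNe p (g x) (g y) := by
  simp only [litNe, QF.map, relabel_tMul, FirstOrder.Language.Term.relabel]

variable {N : Type} [grpLang.Structure N]

theorem realize_lit (v : α → N) (M j n c a m : ℕ) (x y z w : α) :
    (lit M j n c a m x y z w).Realize v ↔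
      (lit M j n c a m (v x) (v y) (v z) (v w)).Realize id := by
  rw [← map_lit, QF.realize_map]; rfl

theorem realize_litNe (v : α → N) (p : ℕ) (x y : α) :
    (litNe p x y).Realize v ↔ (litNe p (v x) (v y)).Realize id := by
  rw [← map_litNe, QF.realize_map]; rfl

end Terms

/-! ## Localizations of `ℤ` as structures for the language of groups -/

/-- The operations of the structure `N` are those of the additive group `N`. -/
structure Compat (N : Type) [grpLang.Structure N] [AddCommGroup N] : Prop where
  zero : ∀ x, FirstOrder.Language.Structure.funMap (L := grpLang) (M := N) GrpFunc.e x = 0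
  neg : ∀ x, FirstOrder.Language.Structure.funMap (L := grpLang) (M := N) GrpFunc.inv x = -(x 0)
  add : ∀ x, FirstOrder.Language.Structure.funMap (L := grpLang) (M := N) GrpFunc.op x = x 0 + x 1

theorem AddSubgroup.compat (H : AddSubgroup ℚ) : Compat H :=
  ⟨fun _ => rfl, fun _ => rfl, fun _ => rfl⟩

/-- The structure satisfies the `Π₂` axioms given by `lit M`. -/
def PiSat (M : ℕ) (N : Type) [grpLang.Structure N] : Prop :=
  ∀ (j n : ℕ) (x y z : N), ∃ (c a m : ℕ) (w : N), (lit M j n c a m x y z w).Realize id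

/-- Some element is not divisible by any of the numbers `q n`. -/
def SigmaSat (q : ℕ → ℕ) (N : Type) [grpLang.Structure N] : Prop :=
  ∃ x : N, ∀ (n : ℕ) (y : N), (litNe (q n) x y).Realize id

/-- A torsion-free abelian group of rank at most one, divisible by every number that is `1`
modulo `M`, and with an element that is divisible by none of the numbers `q n`. -/
structure IsLoc (M : ℕ) (q : ℕ → ℕ) (N : Type) [AddCommGroup N] : Prop where
  torsionFree : ∀ (n : ℕ) (x : N), (n + 1) • x = 0 → x = 0
  div : ∀ (n : ℕ) (x : N), ∃ w : N, (n * M + 1) • w = x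
  rank : ∀ x y : N, y = 0 ∨ ∃ a m : ℕ, (a + 1) • x = m • y ∨ (a + 1) • x = m • (-y)
  gen : ∃ x : N, ∀ (n : ℕ) (y : N), q n • y ≠ x

section Algebra

variable {N : Type} [grpLang.Structure N]

theorem PiSat.exists_addCommGroup {M : ℕ} (h : PiSat M N) :
    ∃ _ : AddCommGroup N, Compat N := by
  let F := fun {n} => FirstOrder.Language.Structure.funMap (L := grpLang) (M := N) (n := n)
  let : Zero N := ⟨F GrpFunc.e ![]⟩
  let : Neg N := ⟨fun x => F GrpFunc.inv ![x]⟩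
  let : Add N := ⟨fun x y => F GrpFunc.op ![x, y]⟩
  have hz : ∀ x, F GrpFunc.e x = 0 := fun x => by
    change F _ _ = F _ _; congr 1; funext i; exact i.elim0
  have hn : ∀ x, F GrpFunc.inv x = - (x 0) := fun x => by
    change F _ _ = F _ _; congr 1; funext i; fin_cases i; rfl
  have ha : ∀ x, F GrpFunc.op x = x 0 + x 1 := fun x => by
    change F _ _ = F _ _; congr 1; funext i; fin_cases i <;> rfl
  have h0 : ∀ x y z : N, x + y + z = x + (y + z) := fun x y z => by
    obtain ⟨c, a, m, w, h⟩ := h 0 0 x y z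
    simp only [lit, QF.Realize, tAdd, FirstOrder.Language.Term.realize, beq_self_eq_true,
      cond_true] at h
    have := h.symm
    simpa only [F, ha, Matrix.cons_val_zero, Matrix.cons_val_one, FirstOrder.Language.Term.realize,
      id] using this
  have h1 : ∀ x y : N, x + y = y + x := fun x y => by
    obtain ⟨c, a, m, w, h⟩ := h 1 0 x y y
    have : (QF.eq (tAdd (.var x) (.var y)) (tAdd (.var y) (.var x)) : QF N).Realize id := h
    simp only [QF.Realize, tAdd, FirstOrder.Language.Term.realize] at this
    simpa only [F, ha, Matrix.cons_val_zero, Matrix.cons_val_one, FirstOrder.Language.Term.realize,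
      id] using this
  have h2 : ∀ x : N, 0 + x = x := fun x => by
    obtain ⟨c, a, m, w, h⟩ := h 2 0 x x x
    have : (QF.eq (tAdd tZero (.var x)) (.var x) : QF N).Realize id := h
    simp only [QF.Realize, tAdd, tZero, FirstOrder.Language.Term.realize] at this
    simpa only [F, ha, hz, Matrix.cons_val_zero, Matrix.cons_val_one,
      FirstOrder.Language.Term.realize, id] using this
  have h3 : ∀ x : N, -x + x = 0 := fun x => by
    obtain ⟨c, a, m, w, h⟩ := h 3 0 x x x
    have : (QF.eq (tAdd (tNeg (.var x)) (.var x)) tZero : QF N).Realize id := h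
    simp only [QF.Realize, tAdd, tZero, tNeg, FirstOrder.Language.Term.realize] at this
    simpa only [F, ha, hz, hn, Matrix.cons_val_zero, Matrix.cons_val_one,
      FirstOrder.Language.Term.realize, id] using this
  let i : AddGroup N := AddGroup.ofLeftAxioms h0 h2 h3
  let i' : AddCommGroup N := { i with add_comm := h1 }
  exact ⟨i', ⟨hz, hn, ha⟩⟩

section

variable [AddCommGroup N]

theorem Compat.realize_tZero (hN : Compat N) {α : Type} (v : α → N) :
    (tZero : grpLang.Term α).realize v = 0 := hN.zero _

theorem Compat.realize_tNeg (hN : Compat N) {α : Type} (v : α → N) (s : grpLang.Term α) :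
    (tNeg s).realize v = -s.realize v := hN.neg _

theorem Compat.realize_tAdd (hN : Compat N) {α : Type} (v : α → N) (s t : grpLang.Term α) :
    (tAdd s t).realize v = s.realize v + t.realize v := hN.add _

theorem Compat.realize_tMul (hN : Compat N) {α : Type} (v : α → N) (s : grpLang.Term α) (n : ℕ) :
    (tMul s n).realize v = n • s.realize v := by
  induction n with
  | zero => rw [zero_smul]; exact hN.realize_tZero v
  | succ n ih => rw [tMul, hN.realize_tAdd, ih, succ_nsmul]

theorem Compat.isLoc_iff (hN : Compat N) (M : ℕ) (q : ℕ → ℕ) :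
    IsLoc M q N ↔ PiSat M N ∧ SigmaSat q N := by
  have hv : ∀ x : N, (.var x : grpLang.Term N).realize id = x := fun _ => rfl
  have key : ∀ j n c a m (x y z w : N), (lit M j n c a m x y z w).Realize id ↔
      bif j == 0 then x + (y + z) = x + y + z else
      bif j == 1 then x + y = y + x else
      bif j == 2 then 0 + x = x else
      bif j == 3 then -x + x = 0 else
      bif j == 4 then (bif c == 0 then (n + 1) • x ≠ 0 else x = 0) else
      bif j == 5 then (n * M + 1) • w = x else
      bif c == 0 then (a + 1) • x = m • y else
      bif c == 1 then (a + 1) • x = m • (-y) else y = 0 := by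
    intro j n c a m x y z w
    simp only [lit, Bool.apply_cond (QF.Realize _), QF.Realize, hN.realize_tZero, hN.realize_tNeg,
      hN.realize_tAdd, hN.realize_tMul, hv]
  have key' : ∀ p (x y : N), (litNe p x y).Realize id ↔ p • y ≠ x := by
    intro p x y
    simp only [litNe, QF.Realize, hN.realize_tMul, hv]
  constructor
  · intro h
    refine ⟨fun j n x y z => ?_, ?_⟩
    · simp only [key]
      match j with
      | 0 => exact ⟨0, 0, 0, x, (add_assoc _ _ _).symm⟩
      | 1 => exact ⟨0, 0, 0, x, add_comm _ _⟩
      | 2 => exact ⟨0, 0, 0, x, zero_add _⟩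
      | 3 => exact ⟨0, 0, 0, x, neg_add_cancel _⟩
      | 4 =>
        by_cases hx : (n + 1) • x = 0
        · exact ⟨1, 0, 0, x, h.torsionFree n x hx⟩
        · exact ⟨0, 0, 0, x, hx⟩
      | 5 =>
        obtain ⟨w, hw⟩ := h.div n x
        exact ⟨0, 0, 0, w, hw⟩
      | j + 6 =>
        rcases h.rank x y with hy | ⟨a, m, hm | hm⟩
        · exact ⟨2, 0, 0, x, hy⟩
        · exact ⟨0, a, m, x, hm⟩
        · exact ⟨1, a, m, x, hm⟩
    · obtain ⟨x, hx⟩ := h.gen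
      exact ⟨x, fun n y => (key' _ _ _).2 (hx n y)⟩
  · rintro ⟨h, x₀, hx₀⟩
    simp only [PiSat, key] at h
    refine ⟨fun n x hx => ?_, fun n x => ?_, fun x y => ?_, x₀, fun n y => (key' _ _ _).1 (hx₀ n y)⟩
    · obtain ⟨c, _, _, _, hc⟩ := h 4 n x x x
      match c with
      | 0 => exact absurd hx hc
      | _ + 1 => exact hc
    · obtain ⟨_, _, _, w, hw⟩ := h 5 n x x x
      exact ⟨w, hw⟩
    · obtain ⟨c, a, m, _, hc⟩ := h 6 0 x y x
      match c with
      | 0 => exact Or.inr ⟨a, m, Or.inl hc⟩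
      | 1 => exact Or.inr ⟨a, m, Or.inr hc⟩
      | _ + 2 => exact Or.inl hc

theorem Compat.grpIso {N' : Type} [grpLang.Structure N'] [AddCommGroup N'] (hN : Compat N)
    (hN' : Compat N') (e : N ≃+ N') : GrpIso N N' := by
  have h : ∀ {n : ℕ} (f : GrpFunc n) (x : Fin n → N),
      e (FirstOrder.Language.Structure.funMap (L := grpLang) f x) =
        FirstOrder.Language.Structure.funMap (L := grpLang) f (e ∘ x) := by
    intro n f x
    match n, f, x with
    | _, GrpFunc.e, x => rw [hN.zero, hN'.zero, map_zero]
    | _, GrpFunc.inv, x => rw [hN.neg, hN'.neg, map_neg]; rfl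
    | _, GrpFunc.op, x => rw [hN.add, hN'.add, map_add]; rfl
  exact ⟨⟨e.toEquiv, fun {n} f x => h f x, fun {n} r => Empty.elim r⟩⟩

end

theorem QF.realize_equiv {N' : Type} [grpLang.Structure N'] (e : FirstOrder.Language.Equiv grpLang N N')
    {α : Type} (v : α → N) (φ : QF α) : φ.Realize (e ∘ v) ↔ φ.Realize v := by
  induction φ with
  | eq s t => simp only [QF.Realize, FirstOrder.Language.HomClass.realize_term]; exact e.injective.eq_iff
  | ne s t => simp only [QF.Realize, FirstOrder.Language.HomClass.realize_term]; exact e.injective.ne_iff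
  | and φ ψ h h' => simp only [QF.Realize, h, h']
  | or φ ψ h h' => simp only [QF.Realize, h, h']

variable {N' : Type} [grpLang.Structure N']

theorem GrpIso.symm (h : GrpIso N N') : GrpIso N' N := h.map fun e => e.symm

theorem GrpIso.trans {N'' : Type} [grpLang.Structure N''] (h : GrpIso N N') (h' : GrpIso N' N'') :
    GrpIso N N'' := h.elim fun e => h'.map fun e' => e'.comp e

theorem PiSat.of_grpIso {M : ℕ} (h : PiSat M N) (e : GrpIso N N') : PiSat M N' := by
  obtain ⟨e⟩ := e
  intro j n x y z
  obtain ⟨c, a, m, w, hw⟩ := h j n (e.symm x) (e.symm y) (e.symm z)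
  refine ⟨c, a, m, e w, ?_⟩
  rw [← QF.realize_equiv e, Function.comp_id, realize_lit] at hw
  simpa using hw

theorem SigmaSat.of_grpIso {q : ℕ → ℕ} (h : SigmaSat q N) (e : GrpIso N N') : SigmaSat q N' := by
  obtain ⟨e⟩ := e
  obtain ⟨x, hx⟩ := h
  refine ⟨e x, fun n y => ?_⟩
  have := hx n (e.symm y)
  rw [← QF.realize_equiv e, Function.comp_id, realize_litNe] at this
  simpa using this

end Algebra

/-! ## Uniqueness of localizations -/

section Loc

variable {N : Type} [AddCommGroup N] {M : ℕ} {q : ℕ → ℕ}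

theorem IsLoc.zsmul_eq_zero (h : IsLoc M q N) {k : ℤ} {x : N} (hx : k • x = 0) (hk : k ≠ 0) :
    x = 0 := by
  have h1 : (k.natAbs) • x = 0 := by
    rcases Int.natAbs_eq k with hk' | hk' <;> rw [hk'] at hx <;> simpa using hx
  obtain ⟨n, hn⟩ := Nat.exists_eq_succ_of_ne_zero (Int.natAbs_ne_zero.2 hk)
  exact h.torsionFree n x (by rwa [hn] at h1)

theorem IsLoc.exists_hom (h : IsLoc M q N) (hq : ∀ n, (q n).Prime ∧ q n ∣ M)
    (hq' : ∀ p, p.Prime → p ∣ M → ∃ n, q n = p) (hM : M ≠ 0) :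
    ∃ f : N →+ ℚ, Function.Injective f ∧ ∀ r, r ∈ f.range ↔ r.den.Coprime M := by
  obtain ⟨x₀, hx₀⟩ := h.gen
  have hx : x₀ ≠ 0 := by
    rintro rfl
    exact hx₀ 0 0 (smul_zero _)
  let R : N → ℚ → Prop := fun y r => ∃ d n : ℤ, d ≠ 0 ∧ d • y = n • x₀ ∧ r = n / d
  have hR : ∀ y, ∃ r, R y r := by
    intro y
    rcases h.rank y x₀ with hy | ⟨a, m, hm | hm⟩
    · exact absurd hy hx
    · exact ⟨_, ((a + 1 : ℕ) : ℤ), m, by positivity, by simpa only [natCast_zsmul] using hm, rfl⟩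
    · exact ⟨_, ((a + 1 : ℕ) : ℤ), -m, by positivity,
        by simpa only [natCast_zsmul, neg_smul, smul_neg] using hm, rfl⟩
  have hfun : ∀ y r r', R y r → R y r' → r = r' := by
    rintro y _ _ ⟨d, n, hd, e, rfl⟩ ⟨d', n', hd', e', rfl⟩
    have h1 : (d' * n - d * n') • x₀ = 0 := by
      rw [sub_smul, mul_smul, mul_smul, ← e, ← e', smul_comm, sub_self]
    have h2 : d' * n - d * n' = 0 := by
      by_contra h3
      exact hx (h.zsmul_eq_zero h1 h3)
    rw [div_eq_div_iff (by exact_mod_cast hd) (by exact_mod_cast hd')]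
    have h4 : n * d' = n' * d := by linarith
    exact_mod_cast h4
  have hadd : ∀ y r y' r', R y r → R y' r' → R (y + y') (r + r') := by
    rintro y _ y' _ ⟨d, n, hd, e, rfl⟩ ⟨d', n', hd', e', rfl⟩
    refine ⟨d * d', n * d' + d * n', mul_ne_zero hd hd', ?_, ?_⟩
    · rw [smul_add, mul_comm d d', mul_smul, e, mul_comm d' d, mul_smul, e', add_smul, mul_smul,
        mul_smul, smul_comm d' n]
    · push_cast
      rw [div_add_div _ _ (by exact_mod_cast hd) (by exact_mod_cast hd')]
  have hlow : ∀ y r, R y r → (r.den : ℤ) • y = r.num • x₀ := by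
    rintro y r ⟨d, n, hd, e, hr⟩
    have h1 : n * r.den = r.num * d := by
      have h2 : r * d = n := by rw [hr]; field_simp
      have h3 : (r.num : ℚ) = r * r.den := (Rat.mul_den_eq_num r).symm
      have : (n * r.den : ℚ) = r.num * d := by rw [h3, ← h2]; ring
      exact_mod_cast this
    rw [← sub_eq_zero]
    refine h.zsmul_eq_zero (k := d) ?_ hd
    rw [smul_sub, smul_comm, e, ← mul_smul, ← mul_smul, ← sub_smul]
    have : (r.den : ℤ) * n - d * r.num = 0 := by linarith
    rw [this, zero_smul]
  choose f hf using hR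
  refine ⟨AddMonoidHom.mk' f fun y y' => hfun _ _ _ (hf _) (hadd _ _ _ _ (hf _) (hf _)), ?_, ?_⟩
  · rw [injective_iff_map_eq_zero]
    intro y hy
    have h1 := hlow y _ (hf y)
    have hy : f y = 0 := hy
    rw [hy] at h1
    simpa using h1
  · intro r
    constructor
    · rintro ⟨y, rfl⟩
      change (f y).den.Coprime M
      have h1 := hlow y _ (hf y)
      by_contra hc
      obtain ⟨p, hp, hpd, hpM⟩ := Nat.Prime.not_coprime_iff_dvd.1 hc
      obtain ⟨n, rfl⟩ := hq' p hp hpM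
      obtain ⟨e, he⟩ := hpd
      have hcop : IsCoprime (f y).num (q n : ℤ) := by
        have : IsCoprime (f y).num ((f y).den : ℤ) := (f y).isCoprime_num_den
        rw [he] at this
        push_cast at this
        exact this.of_mul_right_left
      obtain ⟨u, v, huv⟩ := hcop
      refine hx₀ n (u • (e : ℤ) • y + v • x₀) ?_
      have h2 : (q n : ℤ) • (e : ℤ) • y = (f y).num • x₀ := by
        rw [← mul_smul, ← h1, he]; push_cast; rfl
      rw [← natCast_zsmul, smul_add, smul_comm _ u, h2, smul_comm _ v, ← mul_smul, ← mul_smul,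
        ← add_smul, huv, one_smul]
    · intro hr
      have hM1 : 1 < M := lt_of_lt_of_le (hq 0).1.one_lt (Nat.le_of_dvd (Nat.pos_of_ne_zero hM) (hq 0).2)
      obtain ⟨k, -, hk⟩ := Nat.exists_mul_mod_eq_one_of_coprime hr hM1
      obtain ⟨w, hw⟩ := h.div (r.den * k / M) (r.num • x₀)
      refine ⟨k • w, hfun _ _ _ (hf _) ⟨r.den, r.num, by exact_mod_cast r.den_nz, ?_, ?_⟩⟩
      · rw [← hw, natCast_zsmul, ← mul_smul]
        congr 1
        have := Nat.div_add_mod (r.den * k) M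
        rw [hk] at this
        linarith
      · exact_mod_cast (Rat.num_div_den r).symm

theorem IsLoc.addEquiv {N' : Type} [AddCommGroup N'] (h : IsLoc M q N) (h' : IsLoc M q N')
    (hq : ∀ n, (q n).Prime ∧ q n ∣ M)
    (hq' : ∀ p, p.Prime → p ∣ M → ∃ n, q n = p) (hM : M ≠ 0) : Nonempty (N ≃+ N') := by
  obtain ⟨f, hf, hr⟩ := h.exists_hom hq hq' hM
  obtain ⟨f', hf', hr'⟩ := h'.exists_hom hq hq' hM
  have : f.range = f'.range := by ext r; rw [hr, hr']
  exact ⟨(AddMonoidHom.ofInjective hf).trans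
    ((AddEquiv.addSubgroupCongr this).trans (AddMonoidHom.ofInjective hf').symm)⟩

/-- For subgroups of `ℚ`, the conditions of `IsLoc` reduce to divisibility and non-divisibility. -/
theorem AddSubgroup.isLoc_iff (H : AddSubgroup ℚ) : IsLoc M q H ↔
    (∀ (n : ℕ) (x : H), ∃ w : H, (n * M + 1) • w = x) ∧
      ∃ x : H, ∀ (n : ℕ) (y : H), q n • y ≠ x := by
  refine ⟨fun h => ⟨h.div, h.gen⟩, fun h => ⟨fun n x hx => ?_, h.1, fun x y => ?_, h.2⟩⟩
  · exact (smul_eq_zero.1 hx).resolve_left n.succ_ne_zero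
  · by_cases hy : y = 0
    · exact Or.inl hy
    right
    have hy' : (y : ℚ) ≠ 0 := by simpa using hy
    set r : ℚ := x / y with hr
    have h1 : (r.den : ℚ) * x = r.num * y := by
      have h2 : (x : ℚ) = r * y := by rw [hr]; field_simp
      rw [h2, ← mul_assoc, mul_comm _ r, Rat.mul_den_eq_num]
    obtain ⟨a, ha⟩ := Nat.exists_eq_succ_of_ne_zero r.den_nz
    refine ⟨a, r.num.natAbs, ?_⟩
    rw [ha] at h1
    rcases Int.natAbs_eq r.num with h3 | h3
    · left
      apply Subtype.ext
      rw [h3] at h1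
      simpa [nsmul_eq_mul] using h1
    · right
      apply Subtype.ext
      rw [h3] at h1
      simpa [nsmul_eq_mul] using h1

theorem grpIso_of_sat {N N' : Type} [grpLang.Structure N] [grpLang.Structure N']
    (hq : ∀ n, (q n).Prime ∧ q n ∣ M)
    (hq' : ∀ p, p.Prime → p ∣ M → ∃ n, q n = p) (hM : M ≠ 0)
    (h : PiSat M N ∧ SigmaSat q N) (h' : PiSat M N' ∧ SigmaSat q N') : GrpIso N N' := by
  obtain ⟨_, hN⟩ := h.1.exists_addCommGroup
  obtain ⟨_, hN'⟩ := h'.1.exists_addCommGroup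
  obtain ⟨e⟩ := ((hN.isLoc_iff M q).2 h).addEquiv ((hN'.isLoc_iff M q).2 h') hq hq' hM
  exact hN.grpIso hN' e

end Loc

/-! ## The group `G` -/

theorem exists_not_dividesIn {G : AddSubgroup ℚ} (u : G) (S : Finset ℕ)
    (hS : ∀ p ∈ S, ∃ k, ¬ DividesIn (p ^ k) u) :
    ∃ (x : G) (N : ℕ), u = N • x ∧ ∀ p ∈ S, ¬ DividesIn p x := by
  induction S using Finset.induction_on with
  | empty => exact ⟨u, 1, (one_smul _ _).symm, by simp⟩
  | insert p S hp ih =>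
    obtain ⟨x, N, rfl, hx⟩ := ih fun p hp => hS p (Finset.mem_insert_of_mem hp)
    have h1 : ∃ k, ¬ DividesIn (p ^ k) x := by
      obtain ⟨k, hk⟩ := hS p (Finset.mem_insert_self _ _)
      refine ⟨k, fun ⟨y, hy⟩ => hk ⟨N • y, ?_⟩⟩
      rw [smul_comm, hy]
    classical
    have h2 := Nat.find_spec h1
    obtain ⟨k, hk⟩ : ∃ k, Nat.find h1 = k + 1 := by
      refine Nat.exists_eq_succ_of_ne_zero fun h3 => ?_
      rw [h3] at h2
      exact h2 ⟨x, by simp⟩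
    have h4 := Nat.find_min h1 (m := k) (by omega)
    push Not at h4
    obtain ⟨y, rfl⟩ := h4
    refine ⟨y, N * p ^ k, (mul_smul _ _ _).symm, fun r hr => ?_⟩
    rcases Finset.mem_insert.1 hr with rfl | hr
    · rintro ⟨z, rfl⟩
      rw [hk] at h2
      exact h2 ⟨z, by rw [pow_succ, mul_smul]⟩
    · rintro ⟨z, rfl⟩
      exact hx r hr ⟨p ^ k • z, smul_comm _ _ _⟩

theorem mem_PInf_of_not_mem {G : AddSubgroup ℚ} {u : G} {p : ℕ} (hp : p.Prime) (h0 : p ∉ P0 u)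
    (h1 : p ∉ PFin u) : p ∈ PInf u := by
  refine ⟨hp, fun k hk => ?_⟩
  induction k, hk using Nat.le_induction with
  | base =>
    by_contra h
    exact h0 ⟨hp, by simpa using h⟩
  | succ k hk ih =>
    by_contra h
    exact h1 ⟨hp, k, hk, ih, h⟩

theorem dividesIn_of_mem_PInf {G : AddSubgroup ℚ} {u : G} (hu : u ≠ 0) {p : ℕ} (hp : p ∈ PInf u)
    (x : G) : DividesIn p x := by
  have hu' : (u : ℚ) ≠ 0 := by simpa using hu
  set r : ℚ := x / u with hr
  have h1 : (r.den : ℚ) * x = r.num * u := by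
    have h2 : (x : ℚ) = r * u := by rw [hr]; field_simp
    rw [h2, ← mul_assoc, mul_comm _ r, Rat.mul_den_eq_num]
  obtain ⟨j, a, ha, hd⟩ := Nat.exists_eq_pow_mul_and_not_dvd r.den_nz p hp.1.ne_one
  obtain ⟨v, hv⟩ := hp.2 (j + 1) (by omega)
  have hpj : ((p : ℚ) ^ j) ≠ 0 := pow_ne_zero _ (by exact_mod_cast hp.1.ne_zero)
  have h3 : (a : ℤ) • x = (p : ℤ) • (r.num • v) := by
    apply Subtype.ext
    have hv' : ((p : ℚ) ^ (j + 1)) * v = u := by rw [← hv]; simp [nsmul_eq_mul]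
    rw [hd, ← hv'] at h1
    push_cast at h1
    simp only [AddSubgroup.coe_zsmul, zsmul_eq_mul, Int.cast_natCast]
    apply mul_left_cancel₀ hpj
    linear_combination h1
  have hc : IsCoprime (a : ℤ) (p : ℤ) :=
    Nat.isCoprime_iff_coprime.2 ((Nat.coprime_comm.1 ((Nat.Prime.coprime_iff_not_dvd hp.1).2 ha)))
  obtain ⟨s, t, hst⟩ := hc
  refine ⟨s • r.num • v + t • x, ?_⟩
  rw [← natCast_zsmul, smul_add, smul_comm _ s, ← h3, smul_comm _ t, ← mul_smul, ← mul_smul,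
    ← add_smul, hst, one_smul]

theorem dividesIn_of_primes {G : AddSubgroup ℚ} (n : ℕ) (hn : n ≠ 0)
    (h : ∀ p, p.Prime → p ∣ n → ∀ x : G, DividesIn p x) (x : G) : DividesIn n x := by
  induction n using Nat.recOnMul generalizing x with
  | zero => exact absurd rfl hn
  | one => exact ⟨x, one_smul _ _⟩
  | prime p hp => exact h p hp dvd_rfl x
  | mul a b iha ihb =>
    obtain ⟨ha, hb⟩ := mul_ne_zero_iff.1 hn
    obtain ⟨y, rfl⟩ := iha ha (fun p hp hd => h p hp (hd.mul_right b)) x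
    obtain ⟨z, rfl⟩ := ihb hb (fun p hp hd => h p hp (hd.mul_left a)) y
    exact ⟨z, mul_smul _ _ _⟩

theorem exists_isLoc (G : AddSubgroup ℚ) (u : G) (hu : u ≠ 0)
    (h0 : (P0 u).Finite) (hfin : (PFin u).Finite) (hne : PInf u ≠ {p : ℕ | p.Prime}) :
    ∃ (M : ℕ) (q : ℕ → ℕ), M ≠ 0 ∧ (∀ n, (q n).Prime ∧ q n ∣ M) ∧
      (∀ p, p.Prime → p ∣ M → ∃ n, q n = p) ∧ Computable q ∧ IsLoc M q G := by
  set S : Finset ℕ := (h0.union hfin).toFinset with hS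
  have hmem : ∀ p, p ∈ S ↔ p ∈ P0 u ∨ p ∈ PFin u := fun p => by simp [hS]
  have hprime : ∀ p ∈ S, p.Prime := fun p hp => ((hmem p).1 hp).elim (fun h => h.1) fun h => h.1
  obtain ⟨p₀, hp₀⟩ : ∃ p, p ∈ S := by
    by_contra! h
    refine hne (Set.Subset.antisymm (fun p hp => hp.1) fun p hp => ?_)
    have := h p
    rw [hmem, not_or] at this
    exact mem_PInf_of_not_mem hp this.1 this.2
  let q : ℕ → ℕ := fun n => S.toList.getD n p₀
  have hqS : ∀ n, q n ∈ S := by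
    intro n
    change S.toList.getD n p₀ ∈ S
    rw [List.getD_eq_getElem?_getD]
    rcases h : S.toList[n]? with _ | r
    · exact hp₀
    · exact Finset.mem_toList.1 (List.mem_of_getElem? h)
  have hdvd : ∀ p, p.Prime → p ∣ ∏ p ∈ S, p → p ∈ S := by
    intro p hp hd
    obtain ⟨r, hr, hd⟩ := (Prime.dvd_finsetProd_iff hp.prime _).1 hd
    rwa [(Nat.prime_dvd_prime_iff_eq hp (hprime r hr)).1 hd]
  refine ⟨∏ p ∈ S, p, q, Finset.prod_ne_zero_iff.2 fun p hp => (hprime p hp).ne_zero,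
    fun n => ⟨hprime _ (hqS n), Finset.dvd_prod_of_mem _ (hqS n)⟩, fun p hp hd => ?_, ?_, ?_⟩
  · obtain ⟨n, hn, hn'⟩ := List.getElem_of_mem (Finset.mem_toList.2 (hdvd p hp hd))
    exact ⟨n, by rw [← hn']; exact List.getD_eq_getElem _ _ hn⟩
  · exact ((Primrec.list_getD p₀).comp (Primrec.const _) Primrec.id).to_comp
  · rw [AddSubgroup.isLoc_iff]
    constructor
    · intro n x
      refine dividesIn_of_primes _ (Nat.succ_ne_zero _) (fun p hp hd => ?_) x
      have hpS : p ∉ S := fun h => by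
        have h1 : p ∣ n * ∏ p ∈ S, p := (Finset.dvd_prod_of_mem _ h).mul_left n
        exact hp.one_lt.ne' (Nat.dvd_one.1 ((Nat.dvd_add_right h1).1 hd))
      rw [hmem, not_or] at hpS
      exact dividesIn_of_mem_PInf hu (mem_PInf_of_not_mem hp hpS.1 hpS.2)
    · obtain ⟨x, -, -, hx⟩ := exists_not_dividesIn u S fun p hp => by
        rcases (hmem p).1 hp with h | h
        · exact ⟨1, by rw [pow_one]; exact h.2⟩
        · exact h.2.elim fun k hk => ⟨k + 1, hk.2.2⟩
      exact ⟨x, fun n y hy => hx _ (hqS n) ⟨y, hy⟩⟩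

/-! ## Indices of partial computable functions -/

theorem exists_phi_eq {f : ℕ → ℕ →. ℕ} (hf : Partrec₂ f) :
    ∃ g : ℕ → ℕ, Computable g ∧ ∀ n, phi (g n) = f n := by
  obtain ⟨c, hc⟩ := Nat.Partrec.Code.exists_code.1 (Partrec₂.unpaired'.2 hf)
  refine ⟨fun n => Encodable.encode (c.curry n), ?_, fun n => ?_⟩
  · exact Computable.encode.comp
      (Nat.Partrec.Code.primrec₂_curry.to_comp.comp (Computable.const c) Computable.id)
  · funext x
    simp [phi, Nat.Partrec.Code.eval_curry, hc, Nat.unpaired]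

theorem exists_ceSet_eq {r : ℕ → ℕ → ℕ} (hr : Computable fun p : ℕ × ℕ => r p.1 p.2) :
    ∃ g : ℕ → ℕ, Computable g ∧ ∀ n, ceSet (g n) = Set.range (r n) := by
  have hf : Partrec₂ fun n x : ℕ => Nat.rfind (fun k => r n k == x : ℕ → Bool) := by
    have h : Computable₂ fun (p : ℕ × ℕ) (k : ℕ) => r p.1 k == p.2 := by
      have hr' : Computable fun p : (ℕ × ℕ) × ℕ => r p.1.1 p.2 :=
        hr.comp (f := fun p : ℕ × ℕ => r p.1 p.2) (g := fun p : (ℕ × ℕ) × ℕ => (p.1.1, p.2))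
          (by fun_prop)
      exact Computable.fun_beq hr' (by fun_prop)
    exact Partrec.rfind h.partrec₂
  obtain ⟨g, hg, h⟩ := exists_phi_eq hf
  refine ⟨g, hg, fun n => Set.ext fun x => ?_⟩
  change (phi (g n) x).Dom ↔ _
  rw [h]
  refine Nat.rfind_dom.trans ?_
  simp [PFun.coe_val]

/-! ## The Scott sentence -/

theorem QF.code_injective {α : Type} {c : α → ℕ} (hc : Function.Injective c) :
    Function.Injective (QF.code c) := by
  intro φ
  induction φ with
  | eq s t =>
    intro ψ h
    cases ψ <;> simp only [QF.code] at h <;> try omega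
    have h := Nat.pair_eq_pair.1 (Nat.eq_of_mul_eq_mul_left (by norm_num) h)
    rw [termCode_injective hc h.1, termCode_injective hc h.2]
  | ne s t =>
    intro ψ h
    cases ψ <;> simp only [QF.code] at h <;> try omega
    have h := Nat.pair_eq_pair.1 (Nat.eq_of_mul_eq_mul_left (by norm_num) (Nat.add_right_cancel h))
    rw [termCode_injective hc h.1, termCode_injective hc h.2]
  | and φ ψ h₁ h₂ =>
    intro θ h
    cases θ <;> simp only [QF.code] at h <;> try omega
    have h := Nat.pair_eq_pair.1 (Nat.eq_of_mul_eq_mul_left (by norm_num) (Nat.add_right_cancel h))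
    rw [h₁ h.1, h₂ h.2]
  | or φ ψ h₁ h₂ =>
    intro θ h
    cases θ <;> simp only [QF.code] at h <;> try omega
    have h := Nat.pair_eq_pair.1 (Nat.eq_of_mul_eq_mul_left (by norm_num) (Nat.add_right_cancel h))
    rw [h₁ h.1, h₂ h.2]

instance QF.nonempty {α : Type} : Nonempty (QF α) := ⟨.eq tZero tZero⟩

/-- The quantifier-free formula with a given Gödel number. -/
noncomputable def QF.decode {k : ℕ} : ℕ → QF (Fin k) := Function.invFun (QF.code Fin.val)

theorem QF.decode_code {k : ℕ} (φ : QF (Fin k)) : QF.decode (φ.code Fin.val) = φ :=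
  Function.leftInverse_invFun (QF.code_injective Fin.val_injective) φ

namespace InfFormula

variable {k : ℕ}

/-- The computable `Σ₁` formula with index `e`, all of whose disjuncts have `l` quantifiers. -/
noncomputable def sigmaOne (l e : ℕ) : InfFormula k :=
  disj (ceSet e) (fun _ => l) fun i => qf (QF.decode i.1.unpair.2.unpair.2)

/-- The computable `Π₁` formula with index `e`, all of whose conjuncts have `l` quantifiers. -/
noncomputable def piOne (l e : ℕ) : InfFormula k :=
  conj (ceSet e) (fun _ => l) fun i => qf (QF.decode i.1.unpair.2.unpair.2)

/-- The computable `Σ₂` formula with index `e`, whose disjuncts are `l` quantifiers followed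
by `piOne l'`. -/
noncomputable def sigmaTwo (l l' e : ℕ) : InfFormula k :=
  disj (ceSet e) (fun _ => l) fun i => piOne l' i.1.unpair.2.unpair.2

/-- The computable `Π₂` formula with index `e`, whose conjuncts are `l` quantifiers followed
by `sigmaOne l'`. -/
noncomputable def piTwo (l l' e : ℕ) : InfFormula k :=
  conj (ceSet e) (fun _ => l) fun i => sigmaOne l' i.1.unpair.2.unpair.2

variable {l l' e : ℕ} {r : ℕ → QF (Fin (k + l))}

theorem hasIndex_sigmaOne
    (he : ceSet e = Set.range fun n => Nat.pair 0 (Nat.pair l ((r n).code Fin.val))) :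
    (sigmaOne l e : InfFormula k).HasIndex Kind.sigma 1 e := by
  refine ⟨one_pos, rfl, fun ⟨i, hi⟩ => ?_⟩
  rw [he] at hi
  obtain ⟨n, rfl⟩ := hi
  refine ⟨0, l, (r n).code Fin.val, rfl, one_pos, rfl, rfl, ?_⟩
  simp only [Nat.unpair_pair, QF.decode_code]

theorem hasIndex_piOne
    (he : ceSet e = Set.range fun n => Nat.pair 0 (Nat.pair l ((r n).code Fin.val))) :
    (piOne l e : InfFormula k).HasIndex Kind.pi 1 e := by
  refine ⟨one_pos, rfl, fun ⟨i, hi⟩ => ?_⟩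
  rw [he] at hi
  obtain ⟨n, rfl⟩ := hi
  refine ⟨0, l, (r n).code Fin.val, rfl, one_pos, rfl, rfl, ?_⟩
  simp only [Nat.unpair_pair, QF.decode_code]

theorem hasIndex_sigmaTwo {g : ℕ → ℕ}
    (hg : ∀ n, (piOne l' (g n) : InfFormula (k + l)).HasIndex Kind.pi 1 (g n))
    (he : ceSet e = Set.range fun n => Nat.pair 1 (Nat.pair l (g n))) :
    (sigmaTwo l l' e : InfFormula k).HasIndex Kind.sigma 2 e := by
  refine ⟨two_pos, rfl, fun ⟨i, hi⟩ => ?_⟩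
  rw [he] at hi
  obtain ⟨n, rfl⟩ := hi
  refine ⟨1, l, g n, rfl, one_lt_two, rfl, ?_⟩
  simp only [Nat.unpair_pair]
  exact hg n

theorem hasIndex_piTwo {g : ℕ → ℕ}
    (hg : ∀ n, (sigmaOne l' (g n) : InfFormula (k + l)).HasIndex Kind.sigma 1 (g n))
    (he : ceSet e = Set.range fun n => Nat.pair 1 (Nat.pair l (g n))) :
    (piTwo l l' e : InfFormula k).HasIndex Kind.pi 2 e := by
  refine ⟨two_pos, rfl, fun ⟨i, hi⟩ => ?_⟩
  rw [he] at hi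
  obtain ⟨n, rfl⟩ := hi
  refine ⟨1, l, g n, rfl, one_lt_two, rfl, ?_⟩
  simp only [Nat.unpair_pair]
  exact hg n

variable {N : Type} [grpLang.Structure N] (v : Fin k → N)

theorem realize_sigmaOne
    (he : ceSet e = Set.range fun n => Nat.pair 0 (Nat.pair l ((r n).code Fin.val))) :
    (sigmaOne l e : InfFormula k).Realize v ↔
      ∃ n, ∃ y : Fin l → N, (r n).Realize (Fin.append v y) := by
  simp only [sigmaOne, Realize, Subtype.exists, he, Set.mem_range]
  constructor
  · rintro ⟨_, ⟨n, rfl⟩, y, h⟩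
    exact ⟨n, y, by simpa [QF.decode_code] using h⟩
  · rintro ⟨n, y, h⟩
    exact ⟨_, ⟨n, rfl⟩, y, by simpa [QF.decode_code] using h⟩

theorem realize_piOne
    (he : ceSet e = Set.range fun n => Nat.pair 0 (Nat.pair l ((r n).code Fin.val))) :
    (piOne l e : InfFormula k).Realize v ↔
      ∀ n, ∀ y : Fin l → N, (r n).Realize (Fin.append v y) := by
  simp only [piOne, Realize, Subtype.forall, he, Set.mem_range]
  constructor
  · intro h n y
    have := h _ ⟨n, rfl⟩ y
    simpa [QF.decode_code] using this
  · rintro h _ ⟨n, rfl⟩ y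
    simpa [QF.decode_code] using h n y

theorem realize_sigmaTwo {g : ℕ → ℕ}
    (he : ceSet e = Set.range fun n => Nat.pair 1 (Nat.pair l (g n))) :
    (sigmaTwo l l' e : InfFormula k).Realize v ↔
      ∃ n, ∃ y : Fin l → N, (piOne l' (g n) : InfFormula (k + l)).Realize (Fin.append v y) := by
  simp only [sigmaTwo, Realize, Subtype.exists, he, Set.mem_range]
  constructor
  · rintro ⟨_, ⟨n, rfl⟩, y, h⟩
    exact ⟨n, y, by simpa using h⟩
  · rintro ⟨n, y, h⟩
    exact ⟨_, ⟨n, rfl⟩, y, by simpa using h⟩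

theorem realize_piTwo {g : ℕ → ℕ}
    (he : ceSet e = Set.range fun n => Nat.pair 1 (Nat.pair l (g n))) :
    (piTwo l l' e : InfFormula k).Realize v ↔
      ∀ n, ∀ y : Fin l → N, (sigmaOne l' (g n) : InfFormula (k + l)).Realize (Fin.append v y) := by
  simp only [piTwo, Realize, Subtype.forall, he, Set.mem_range]
  constructor
  · intro h n y
    have := h _ ⟨n, rfl⟩ y
    simpa using this
  · rintro h _ ⟨n, rfl⟩ y
    simpa using h n y

end InfFormula

open InfFormula in
theorem exists_piSat_formula (M : ℕ) : ∃ π : InfFormula 0, π.IsComputablePi 2 ∧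
    ∀ (N : Type) [grpLang.Structure N], π.Realize (Fin.elim0 : Fin 0 → N) ↔ PiSat M N := by
  let R : ℕ → ℕ → QF (Fin (0 + 3 + 1)) := fun n k =>
    lit M n.unpair.1 n.unpair.2 k.unpair.1 k.unpair.2.unpair.1 k.unpair.2.unpair.2 0 1 2 3
  obtain ⟨g, hg, hg'⟩ := exists_ceSet_eq
    (r := fun n k => Nat.pair 0 (Nat.pair 1 ((R n k).code Fin.val))) (by
      simp only [R, code_lit]
      fun_prop)
  obtain ⟨e, -, he⟩ := exists_ceSet_eq (r := fun _ n => Nat.pair 1 (Nat.pair 3 (g n))) (by fun_prop)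
  refine ⟨piTwo 3 1 (e 0), ⟨e 0, hasIndex_piTwo (fun n => hasIndex_sigmaOne (hg' n)) (he 0)⟩,
    fun N _ => ?_⟩
  rw [realize_piTwo _ (he 0)]
  simp only [realize_sigmaOne _ (hg' _)]
  have key : ∀ n k (v : Fin 3 → N) (w : Fin 1 → N),
      (R n k).Realize (Fin.append (Fin.append Fin.elim0 v) w) ↔
        (lit M n.unpair.1 n.unpair.2 k.unpair.1 k.unpair.2.unpair.1 k.unpair.2.unpair.2
          (v 0) (v 1) (v 2) (w 0)).Realize id := by
    intro n k v w
    rw [realize_lit]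
    rfl
  simp only [key]
  constructor
  · intro h j n x y z
    obtain ⟨k, w, hw⟩ := h (Nat.pair j n) ![x, y, z]
    rw [Nat.unpair_pair] at hw
    exact ⟨_, _, _, _, hw⟩
  · intro h n v
    obtain ⟨c, a, m, w, hw⟩ := h n.unpair.1 n.unpair.2 (v 0) (v 1) (v 2)
    exact ⟨Nat.pair c (Nat.pair a m), ![w], by simpa using hw⟩

open InfFormula in
theorem exists_sigmaSat_formula {q : ℕ → ℕ} (hq : Computable q) :
    ∃ σ : InfFormula 0, σ.IsComputableSigma 2 ∧
      ∀ (N : Type) [grpLang.Structure N], σ.Realize (Fin.elim0 : Fin 0 → N) ↔ SigmaSat q N := by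
  let R : ℕ → QF (Fin (0 + 1 + 1)) := fun n => litNe (q n) 0 1
  obtain ⟨g, hg, hg'⟩ := exists_ceSet_eq
    (r := fun _ n => Nat.pair 0 (Nat.pair 1 ((R n).code Fin.val))) (by
      simp only [R, code_litNe]
      fun_prop)
  obtain ⟨e, -, he⟩ := exists_ceSet_eq (r := fun _ n => Nat.pair 1 (Nat.pair 1 (g n))) (by fun_prop)
  refine ⟨sigmaTwo 1 1 (e 0), ⟨e 0, hasIndex_sigmaTwo (fun n => hasIndex_piOne (hg' n)) (he 0)⟩,
    fun N _ => ?_⟩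
  rw [realize_sigmaTwo _ (he 0)]
  simp only [realize_piOne _ (hg' _)]
  have key : ∀ n (v : Fin 1 → N) (w : Fin 1 → N),
      (R n).Realize (Fin.append (Fin.append Fin.elim0 v) w) ↔
        (litNe (q n) (v 0) (w 0)).Realize id := by
    intro n v w
    rw [realize_litNe]
    rfl
  simp only [key]
  constructor
  · rintro ⟨-, v, h⟩
    exact ⟨v 0, fun n y => h n ![y]⟩
  · rintro ⟨x, h⟩
    exact ⟨0, ![x], fun n y => h n (y 0)⟩

theorem exists_scottSentence {G : AddSubgroup ℚ} {M : ℕ} {q : ℕ → ℕ} (hM : M ≠ 0)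
    (hq : ∀ n, (q n).Prime ∧ q n ∣ M) (hq' : ∀ p, p.Prime → p ∣ M → ∃ n, q n = p)
    (hqc : Computable q) (hG : IsLoc M q G) :
    ∃ φ : InfFormula 0, φ.IsComputableDSigma2 ∧ IsScottSentence φ G := by
  obtain ⟨π, hπ, hπ'⟩ := exists_piSat_formula M
  obtain ⟨σ, hσ, hσ'⟩ := exists_sigmaSat_formula hqc
  have hG' := (G.compat.isLoc_iff M q).1 hG
  refine ⟨σ.inf π, ⟨σ, π, hσ, hπ, rfl⟩, fun N _ _ => ?_⟩
  rw [InfFormula.realize_inf, hπ', hσ']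
  exact ⟨fun h => grpIso_of_sat hq hq' hM h.symm hG',
    fun h => ⟨hG'.2.of_grpIso h.symm, hG'.1.of_grpIso h.symm⟩⟩

/-! ## `Π⁰₂` sets -/

/-- `S` is `Π⁰₂`. -/
def IsPi02 (S : Set ℕ) : Prop :=
  ∃ R : ℕ × ℕ × ℕ → Bool, Computable R ∧ ∀ n, n ∈ S ↔ ∀ x, ∃ y, R (n, x, y) = true

theorem IsPi02.compl {S : Set ℕ} (h : IsPi02 S) : IsSigma02 Sᶜ := by
  obtain ⟨R, hR, h⟩ := h
  refine ⟨fun p => R p = false, ⟨inferInstance, ?_⟩, fun n => ?_⟩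
  · exact (Computable.fun_not hR).of_eq fun p => by cases h : R p <;> simp [h]
  · rw [Set.mem_compl_iff, h]
    simp

theorem IsPi02.inter {S T : Set ℕ} (hS : IsPi02 S) (hT : IsPi02 T) : IsPi02 (S ∩ T) := by
  obtain ⟨R, hR, h⟩ := hS
  obtain ⟨R', hR', h'⟩ := hT
  refine ⟨fun p => R (p.1, p.2.1, p.2.2.unpair.1) && R' (p.1, p.2.1, p.2.2.unpair.2),
    by fun_prop, fun n => ?_⟩
  rw [Set.mem_inter_iff, h, h']
  simp only [Bool.and_eq_true]
  constructor
  · rintro ⟨h₁, h₂⟩ x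
    obtain ⟨y, hy⟩ := h₁ x
    obtain ⟨z, hz⟩ := h₂ x
    exact ⟨Nat.pair y z, by simpa using ⟨hy, hz⟩⟩
  · intro h
    exact ⟨fun x => (h x).imp' _ fun _ h => h.1, fun x => (h x).imp' _ fun _ h => h.2⟩

theorem isPi02_of_denumerable {α β : Type} [Denumerable α] [Denumerable β] {R : ℕ × α × β → Bool}
    (hR : Computable R) : IsPi02 {n | ∀ x, ∃ y, R (n, x, y) = true} := by
  refine ⟨fun p => R (p.1, Denumerable.ofNat α p.2.1, Denumerable.ofNat β p.2.2), by fun_prop,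
    fun n => ⟨fun h x => ?_, fun h x => ?_⟩⟩
  · obtain ⟨y, hy⟩ := h (Denumerable.ofNat α x)
    exact ⟨Encodable.encode y, by simpa using hy⟩
  · obtain ⟨y, hy⟩ := h (Encodable.encode x)
    exact ⟨Denumerable.ofNat β y, by simpa using hy⟩

theorem isSigma02_of_denumerable {α β : Type} [Denumerable α] [Denumerable β]
    {R : ℕ × α × β → Bool} (hR : Computable R) : IsSigma02 {n | ∃ x, ∀ y, R (n, x, y) = true} := by
  convert (isPi02_of_denumerable (Computable.fun_not hR)).compl using 1
  ext n
  simp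

/-- The set on which the `e`-th partial computable function has the value `1`. -/
def posSet (e : ℕ) : Set ℕ := {n | 1 ∈ phi e n}

/-- The `e`-th partial computable function has the value `b` at `n`, within `s` steps. -/
def stageEval (b s e n : ℕ) : Bool :=
  Nat.Partrec.Code.evaln s (Denumerable.ofNat Nat.Partrec.Code e) n == some b

@[fun_prop]
theorem Computable.fun_stageEval {α : Type*} [Primcodable α] {b s e n : α → ℕ} (hb : Computable b)
    (hs : Computable s) (he : Computable e) (hn : Computable n) :
    Computable fun x => stageEval (b x) (s x) (e x) (n x) := by
  have h := Nat.Partrec.Code.primrec_evaln.to_comp.comp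
    (g := fun x => ((s x, Denumerable.ofNat Nat.Partrec.Code (e x)), n x)) (by fun_prop)
  exact Computable.fun_beq h (Computable.option_some.comp hb)

theorem mem_phi_iff {b e n : ℕ} : b ∈ phi e n ↔ ∃ s, stageEval b s e n = true := by
  rw [phi, Nat.Partrec.Code.evaln_complete]
  simp [stageEval]

theorem mem_posSet_iff {e n : ℕ} : n ∈ posSet e ↔ ∃ s, stageEval 1 s e n = true := mem_phi_iff

theorem isPi02_horn {α β : Type} [Denumerable α] [Denumerable β] {g₁ g₂ g₃ : α → ℕ}
    {P : α → Bool} {h₁ h₂ : α × β → ℕ} (hg₁ : Computable g₁) (hg₂ : Computable g₂)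
    (hg₃ : Computable g₃) (hP : Computable P) (hh₁ : Computable h₁) (hh₂ : Computable h₂) :
    IsPi02 {e | ∀ x, g₁ x ∈ posSet e → g₂ x ∈ posSet e → g₃ x ∈ posSet e → P x = true ∨
      ∃ y, h₁ (x, y) ∈ posSet e ∧ h₂ (x, y) ∈ posSet e} := by
  have h := isPi02_of_denumerable (α := α × ℕ × ℕ × ℕ) (β := β × ℕ × ℕ)
    (R := fun p => !stageEval 1 p.2.1.2.1 p.1 (g₁ p.2.1.1) ||
      !stageEval 1 p.2.1.2.2.1 p.1 (g₂ p.2.1.1) || !stageEval 1 p.2.1.2.2.2 p.1 (g₃ p.2.1.1) ||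
      P p.2.1.1 || (stageEval 1 p.2.2.2.1 p.1 (h₁ (p.2.1.1, p.2.2.1)) &&
        stageEval 1 p.2.2.2.2 p.1 (h₂ (p.2.1.1, p.2.2.1)))) (by fun_prop)
  convert h using 1
  ext e
  simp only [Set.mem_ofPred_eq, mem_posSet_iff, Bool.or_eq_true, Bool.and_eq_true,
    Bool.not_eq_true', Prod.forall, Prod.exists]
  constructor
  · intro h x s₁ s₂ s₃
    by_cases e₁ : stageEval 1 s₁ e (g₁ x) = true
    · by_cases e₂ : stageEval 1 s₂ e (g₂ x) = true
      · by_cases e₃ : stageEval 1 s₃ e (g₃ x) = true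
        · rcases h x ⟨_, e₁⟩ ⟨_, e₂⟩ ⟨_, e₃⟩ with h | ⟨y, ⟨t₁, h₁⟩, t₂, h₂⟩
          · exact ⟨Denumerable.ofNat β 0, 0, 0, Or.inl (Or.inr h)⟩
          · exact ⟨y, t₁, t₂, Or.inr ⟨h₁, h₂⟩⟩
        · exact ⟨Denumerable.ofNat β 0, 0, 0, Or.inl (Or.inl (Or.inr (by simpa using e₃)))⟩
      · exact ⟨Denumerable.ofNat β 0, 0, 0, Or.inl (Or.inl (Or.inl (Or.inr (by simpa using e₂))))⟩
    · exact ⟨Denumerable.ofNat β 0, 0, 0, Or.inl (Or.inl (Or.inl (Or.inl (by simpa using e₁))))⟩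
  · rintro h x ⟨s₁, e₁⟩ ⟨s₂, e₂⟩ ⟨s₃, e₃⟩
    obtain ⟨y, t₁, t₂, h⟩ := h x s₁ s₂ s₃
    rw [e₁, e₂, e₃] at h
    simp only [Bool.true_eq_false, false_or] at h
    exact h.imp_right fun h => ⟨y, ⟨t₁, h.1⟩, t₂, h.2⟩

theorem isPi02_horn_and {α : Type} [Denumerable α] {g₁ g₂ h₁ h₂ : α → ℕ}
    (hg₁ : Computable g₁) (hg₂ : Computable g₂) (hh₁ : Computable h₁) (hh₂ : Computable h₂) :
    IsPi02 {e | ∀ x, g₁ x ∈ posSet e → g₂ x ∈ posSet e → h₁ x ∈ posSet e ∧ h₂ x ∈ posSet e} := by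
  simpa using isPi02_horn (β := ℕ) (P := fun _ => false) (h₁ := fun x => h₁ x.1)
    (h₂ := fun x => h₂ x.1) hg₁ hg₂ hg₂ (by fun_prop) (by fun_prop) (by fun_prop)

theorem isPi02_horn_exists {α : Type} [Denumerable α] {g₁ g₂ : α → ℕ} {h : α × ℕ → ℕ}
    (hg₁ : Computable g₁) (hg₂ : Computable g₂) (hh : Computable h) :
    IsPi02 {e | ∀ x, g₁ x ∈ posSet e → g₂ x ∈ posSet e → ∃ y, h (x, y) ∈ posSet e} := by
  simpa using isPi02_horn (P := fun _ => false) hg₁ hg₂ hg₂ (by fun_prop) hh hh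

theorem isPi02_horn_pred {α : Type} [Denumerable α] {g₁ g₂ : α → ℕ} {P : α → Bool}
    (hg₁ : Computable g₁) (hg₂ : Computable g₂) (hP : Computable P) :
    IsPi02 {e | ∀ x, g₁ x ∈ posSet e → g₂ x ∈ posSet e → P x = true} := by
  have h := isPi02_of_denumerable (α := α × ℕ × ℕ) (β := ℕ)
    (R := fun p => !stageEval 1 p.2.1.2.1 p.1 (g₁ p.2.1.1) ||
      !stageEval 1 p.2.1.2.2 p.1 (g₂ p.2.1.1) || P p.2.1.1) (by fun_prop)
  convert h using 1
  ext e
  simp only [Set.mem_ofPred_eq, mem_posSet_iff, Bool.or_eq_true, Bool.not_eq_true', exists_const,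
    Prod.forall]
  constructor
  · intro h x s₁ s₂
    by_cases e₁ : stageEval 1 s₁ e (g₁ x) = true
    · by_cases e₂ : stageEval 1 s₂ e (g₂ x) = true
      · exact Or.inr (h x ⟨_, e₁⟩ ⟨_, e₂⟩)
      · exact Or.inl (Or.inr (by simpa using e₂))
    · exact Or.inl (Or.inl (by simpa using e₁))
  · rintro h x ⟨s₁, e₁⟩ ⟨s₂, e₂⟩
    simpa [e₁, e₂] using h x s₁ s₂

/-! ## Atomic diagrams -/

/-- The conditions that characterize the atomic diagrams among the sets of natural numbers. -/
structure IsDiagram (X : Set ℕ) : Prop where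
  symm : ∀ s t, 4 * Nat.pair s t ∈ X → 4 * Nat.pair t s ∈ X
  trans : ∀ s t r, 4 * Nat.pair s t ∈ X → 4 * Nat.pair t r ∈ X → 4 * Nat.pair s r ∈ X
  val : ∀ s, 4 * Nat.pair s s ∈ X → ∃ a, 4 * Nat.pair s (3 * a + 1) ∈ X
  const : ∀ a b, 4 * Nat.pair (3 * a + 1) (3 * b + 1) ∈ X → a = b
  zero : 4 * Nat.pair 0 0 ∈ X
  neg_dom : ∀ s, 4 * Nat.pair (3 * s + 2) (3 * s + 2) ∈ X → 4 * Nat.pair s s ∈ X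
  add_dom : ∀ s t, 4 * Nat.pair (3 * Nat.pair s t + 3) (3 * Nat.pair s t + 3) ∈ X →
    4 * Nat.pair s s ∈ X ∧ 4 * Nat.pair t t ∈ X
  neg_congr : ∀ s t, 4 * Nat.pair s t ∈ X → 4 * Nat.pair (3 * s + 2) (3 * t + 2) ∈ X
  add_congr : ∀ s s' t t', 4 * Nat.pair s s' ∈ X → 4 * Nat.pair t t' ∈ X →
    4 * Nat.pair (3 * Nat.pair s t + 3) (3 * Nat.pair s' t' + 3) ∈ X
  total : ∀ s t, 4 * Nat.pair s s ∈ X → 4 * Nat.pair t t ∈ X →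
    4 * Nat.pair s t ∈ X ∨ 4 * Nat.pair s t + 1 ∈ X
  ne_dom : ∀ s t, 4 * Nat.pair s t + 1 ∈ X → 4 * Nat.pair s s ∈ X ∧ 4 * Nat.pair t t ∈ X
  consistent : ∀ s t, 4 * Nat.pair s t ∈ X → 4 * Nat.pair s t + 1 ∉ X
  atomic : ∀ n ∈ X, n % 4 = 0 ∨ n % 4 = 1

theorem isPi02_isDiagram : IsPi02 {e | IsDiagram (posSet e)} := by
  let E : ℕ → ℕ → ℕ := fun s t => 4 * Nat.pair s t
  have hE : ∀ {f g : ℕ × ℕ × ℕ × ℕ → ℕ}, Computable f → Computable g →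
      Computable fun x => E (f x) (g x) := fun hf hg => by
    change Computable fun x => 4 * Nat.pair _ _
    fun_prop
  have symm : IsPi02 {e | ∀ x : ℕ × ℕ × ℕ × ℕ, E x.1 x.2.1 ∈ posSet e → E x.1 x.2.1 ∈ posSet e →
      E x.2.1 x.1 ∈ posSet e ∧ E x.2.1 x.1 ∈ posSet e} :=
    isPi02_horn_and (hE (by fun_prop) (by fun_prop)) (hE (by fun_prop) (by fun_prop))
      (hE (by fun_prop) (by fun_prop)) (hE (by fun_prop) (by fun_prop))
  have trans : IsPi02 {e | ∀ x : ℕ × ℕ × ℕ × ℕ, E x.1 x.2.1 ∈ posSet e →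
      E x.2.1 x.2.2.1 ∈ posSet e → E x.1 x.2.2.1 ∈ posSet e ∧ E x.1 x.2.2.1 ∈ posSet e} :=
    isPi02_horn_and (hE (by fun_prop) (by fun_prop)) (hE (by fun_prop) (by fun_prop))
      (hE (by fun_prop) (by fun_prop)) (hE (by fun_prop) (by fun_prop))
  have val : IsPi02 {e | ∀ s : ℕ, 4 * Nat.pair s s ∈ posSet e → 4 * Nat.pair s s ∈ posSet e →
      ∃ a, 4 * Nat.pair s (3 * a + 1) ∈ posSet e} :=
    isPi02_horn_exists (h := fun x => 4 * Nat.pair x.1 (3 * x.2 + 1))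
      (by fun_prop) (by fun_prop) (by fun_prop)
  have const : IsPi02 {e | ∀ x : ℕ × ℕ, 4 * Nat.pair (3 * x.1 + 1) (3 * x.2 + 1) ∈ posSet e →
      4 * Nat.pair (3 * x.1 + 1) (3 * x.2 + 1) ∈ posSet e → (x.1 == x.2) = true} :=
    isPi02_horn_pred (by fun_prop) (by fun_prop) (by fun_prop)
  have zero : IsPi02 {e | ∀ _ : ℕ, ∃ y, stageEval 1 y e (4 * Nat.pair 0 0) = true} :=
    isPi02_of_denumerable (R := fun p : ℕ × ℕ × ℕ => stageEval 1 p.2.2 p.1 (4 * Nat.pair 0 0))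
      (by fun_prop)
  have neg_dom : IsPi02 {e | ∀ s : ℕ, 4 * Nat.pair (3 * s + 2) (3 * s + 2) ∈ posSet e →
      4 * Nat.pair (3 * s + 2) (3 * s + 2) ∈ posSet e →
      4 * Nat.pair s s ∈ posSet e ∧ 4 * Nat.pair s s ∈ posSet e} :=
    isPi02_horn_and (by fun_prop) (by fun_prop) (by fun_prop) (by fun_prop)
  have add_dom : IsPi02 {e | ∀ x : ℕ × ℕ × ℕ × ℕ,
      E (3 * Nat.pair x.1 x.2.1 + 3) (3 * Nat.pair x.1 x.2.1 + 3) ∈ posSet e →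
      E (3 * Nat.pair x.1 x.2.1 + 3) (3 * Nat.pair x.1 x.2.1 + 3) ∈ posSet e →
      E x.1 x.1 ∈ posSet e ∧ E x.2.1 x.2.1 ∈ posSet e} :=
    isPi02_horn_and (hE (by fun_prop) (by fun_prop)) (hE (by fun_prop) (by fun_prop))
      (hE (by fun_prop) (by fun_prop)) (hE (by fun_prop) (by fun_prop))
  have neg_congr : IsPi02 {e | ∀ x : ℕ × ℕ × ℕ × ℕ, E x.1 x.2.1 ∈ posSet e →
      E x.1 x.2.1 ∈ posSet e →
      E (3 * x.1 + 2) (3 * x.2.1 + 2) ∈ posSet e ∧ E (3 * x.1 + 2) (3 * x.2.1 + 2) ∈ posSet e} :=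
    isPi02_horn_and (hE (by fun_prop) (by fun_prop)) (hE (by fun_prop) (by fun_prop))
      (hE (by fun_prop) (by fun_prop)) (hE (by fun_prop) (by fun_prop))
  have add_congr : IsPi02 {e | ∀ x : ℕ × ℕ × ℕ × ℕ, E x.1 x.2.1 ∈ posSet e →
      E x.2.2.1 x.2.2.2 ∈ posSet e →
      E (3 * Nat.pair x.1 x.2.2.1 + 3) (3 * Nat.pair x.2.1 x.2.2.2 + 3) ∈ posSet e ∧
      E (3 * Nat.pair x.1 x.2.2.1 + 3) (3 * Nat.pair x.2.1 x.2.2.2 + 3) ∈ posSet e} :=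
    isPi02_horn_and (hE (by fun_prop) (by fun_prop)) (hE (by fun_prop) (by fun_prop))
      (hE (by fun_prop) (by fun_prop)) (hE (by fun_prop) (by fun_prop))
  have total : IsPi02 {e | ∀ x : ℕ × ℕ, 4 * Nat.pair x.1 x.1 ∈ posSet e →
      4 * Nat.pair x.2 x.2 ∈ posSet e →
      ∃ y, 4 * Nat.pair x.1 x.2 + (bif y == 0 then 0 else 1) ∈ posSet e} :=
    isPi02_horn_exists
      (h := fun x : (ℕ × ℕ) × ℕ => 4 * Nat.pair x.1.1 x.1.2 + (bif x.2 == 0 then 0 else 1))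
      (by fun_prop) (by fun_prop) (by fun_prop)
  have ne_dom : IsPi02 {e | ∀ x : ℕ × ℕ, 4 * Nat.pair x.1 x.2 + 1 ∈ posSet e →
      4 * Nat.pair x.1 x.2 + 1 ∈ posSet e →
      4 * Nat.pair x.1 x.1 ∈ posSet e ∧ 4 * Nat.pair x.2 x.2 ∈ posSet e} :=
    isPi02_horn_and (by fun_prop) (by fun_prop) (by fun_prop) (by fun_prop)
  have consistent : IsPi02 {e | ∀ x : ℕ × ℕ, 4 * Nat.pair x.1 x.2 ∈ posSet e →
      4 * Nat.pair x.1 x.2 + 1 ∈ posSet e → false = true} :=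
    isPi02_horn_pred (P := fun _ => false) (by fun_prop) (by fun_prop) (by fun_prop)
  have atomic : IsPi02 {e | ∀ n : ℕ, n ∈ posSet e → n ∈ posSet e →
      (n % 4 == 0 || n % 4 == 1) = true} :=
    isPi02_horn_pred (by fun_prop) (by fun_prop) (by fun_prop)
  convert symm.inter <| trans.inter <| val.inter <| const.inter <| zero.inter <| neg_dom.inter <|
    add_dom.inter <| neg_congr.inter <| add_congr.inter <| total.inter <| ne_dom.inter <|
    consistent.inter atomic using 1
  ext e
  simp only [Set.mem_inter_iff, Set.mem_ofPred_eq, Prod.forall, and_self, beq_iff_eq,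
    Bool.or_eq_true, forall_const, ← mem_posSet_iff, E, Bool.false_eq_true]
  constructor
  · intro h
    refine ⟨fun s t h₁ _ => h.symm s t h₁, h.trans, fun s h₁ _ => h.val s h₁,
      fun a b h₁ _ => h.const a b h₁, h.zero, fun s h₁ _ => h.neg_dom s h₁,
      fun s t h₁ _ => h.add_dom s t h₁, fun s t h₁ _ => h.neg_congr s t h₁, h.add_congr,
      fun s t h₁ h₂ => ?_, fun s t h₁ _ => h.ne_dom s t h₁, h.consistent, fun n h₁ _ => h.atomic n h₁⟩
    rcases h.total s t h₁ h₂ with h | h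
    · exact ⟨0, h⟩
    · exact ⟨1, h⟩
  · rintro ⟨h₁, h₂, h₃, h₄, h₅, h₆, h₇, h₈, h₉, h₁₀, h₁₁, h₁₂, h₁₃⟩
    refine ⟨fun s t h => h₁ s t h h, h₂, fun s h => h₃ s h h,
      fun a b h => h₄ a b h h, h₅, fun s h => h₆ s h h, fun s t h => h₇ s t h h,
      fun s t h => h₈ s t h h, h₉, fun s t h h' => ?_, fun s t h => h₁₁ s t h h, h₁₂,
      fun n h => h₁₃ n h h⟩
    obtain ⟨y, hy⟩ := h₁₀ s t h h'
    cases hc : y == 0 <;> rw [hc] at hy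
    · exact Or.inr hy
    · exact Or.inl hy

section Diagram

variable {A : Set ℕ}

theorem const_of_termCode {s : grpLang.Term A} {a : ℕ} (h : termCode Subtype.val s = 3 * a + 1) :
    ∃ x : A, x.1 = a ∧ s = .var x := by
  match s, h with
  | .var x, h => exact ⟨x, by simp only [termCode] at h; omega, rfl⟩
  | .func GrpFunc.e _, h => simp only [termCode] at h; omega
  | .func GrpFunc.inv _, h => simp only [termCode] at h; omega
  | .func GrpFunc.op _, h => simp only [termCode] at h; omega

theorem neg_of_termCode {s : grpLang.Term A} {m : ℕ} (h : termCode Subtype.val s = 3 * m + 2) :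
    ∃ t : grpLang.Term A, termCode Subtype.val t = m := by
  match s, h with
  | .var x, h => simp only [termCode] at h; omega
  | .func GrpFunc.e _, h => simp only [termCode] at h; omega
  | .func GrpFunc.inv ts, h => exact ⟨ts 0, by simp only [termCode] at h; omega⟩
  | .func GrpFunc.op _, h => simp only [termCode] at h; omega

theorem add_of_termCode {s : grpLang.Term A} {m n : ℕ}
    (h : termCode Subtype.val s = 3 * Nat.pair m n + 3) :
    (∃ t : grpLang.Term A, termCode Subtype.val t = m) ∧
      ∃ t : grpLang.Term A, termCode Subtype.val t = n := by
  match s, h with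
  | .var x, h => simp only [termCode] at h; omega
  | .func GrpFunc.e _, h => simp only [termCode] at h; omega
  | .func GrpFunc.inv ts, h => simp only [termCode] at h; omega
  | .func GrpFunc.op ts, h =>
    simp only [termCode] at h
    have h' := Nat.pair_eq_pair.1 (by omega : Nat.pair (termCode Subtype.val (ts 0))
      (termCode Subtype.val (ts 1)) = Nat.pair m n)
    exact ⟨⟨ts 0, h'.1⟩, ts 1, h'.2⟩

variable [grpLang.Structure A]

theorem eq_mem_atomicDiagram_iff {m n : ℕ} : 4 * Nat.pair m n ∈ atomicDiagram A ↔
    ∃ s t : grpLang.Term A, termCode Subtype.val s = m ∧ termCode Subtype.val t = n ∧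
      s.realize id = t.realize id := by
  constructor
  · rintro ⟨s, t, φ, rfl | rfl, h, hc⟩
    · have := Nat.pair_eq_pair.1 (Nat.eq_of_mul_eq_mul_left (by norm_num) hc)
      exact ⟨s, t, this.1.symm, this.2.symm, h⟩
    · simp only [QF.code] at hc
      omega
  · rintro ⟨s, t, rfl, rfl, h⟩
    exact ⟨s, t, _, Or.inl rfl, h, rfl⟩

theorem ne_mem_atomicDiagram_iff {m n : ℕ} : 4 * Nat.pair m n + 1 ∈ atomicDiagram A ↔
    ∃ s t : grpLang.Term A, termCode Subtype.val s = m ∧ termCode Subtype.val t = n ∧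
      s.realize id ≠ t.realize id := by
  constructor
  · rintro ⟨s, t, φ, rfl | rfl, h, hc⟩
    · simp only [QF.code] at hc
      omega
    · have := Nat.pair_eq_pair.1 (Nat.eq_of_mul_eq_mul_left (by norm_num) (Nat.add_right_cancel hc))
      exact ⟨s, t, this.1.symm, this.2.symm, h⟩
  · rintro ⟨s, t, rfl, rfl, h⟩
    exact ⟨s, t, _, Or.inr rfl, h, rfl⟩

theorem self_mem_atomicDiagram_iff {m : ℕ} : 4 * Nat.pair m m ∈ atomicDiagram A ↔
    ∃ s : grpLang.Term A, termCode Subtype.val s = m :=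
  eq_mem_atomicDiagram_iff.trans ⟨fun ⟨s, _, h, _⟩ => ⟨s, h⟩, fun ⟨s, h⟩ => ⟨s, s, h, h, rfl⟩⟩

theorem const_mem_atomicDiagram_iff {a : ℕ} :
    4 * Nat.pair (3 * a + 1) (3 * a + 1) ∈ atomicDiagram A ↔ a ∈ A := by
  rw [self_mem_atomicDiagram_iff]
  constructor
  · rintro ⟨s, hs⟩
    obtain ⟨x, rfl, -⟩ := const_of_termCode hs
    exact x.2
  · intro h
    exact ⟨.var ⟨a, h⟩, rfl⟩

theorem realize_tNeg_congr {s t : grpLang.Term A} (h : s.realize id = t.realize id) :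
    (tNeg s).realize id = (tNeg t).realize id := by
  simp only [tNeg, FirstOrder.Language.Term.realize]
  congr 1; funext i; fin_cases i
  exact h

theorem realize_tAdd_congr {s s' t t' : grpLang.Term A} (h : s.realize id = s'.realize id)
    (h' : t.realize id = t'.realize id) : (tAdd s t).realize id = (tAdd s' t').realize id := by
  simp only [tAdd, FirstOrder.Language.Term.realize]
  congr 1; funext i; fin_cases i
  · exact h
  · exact h'

theorem isDiagram_atomicDiagram (A : Set ℕ) [grpLang.Structure A] : IsDiagram (atomicDiagram A) := by
  have inj : Function.Injective (termCode (Subtype.val : A → ℕ)) :=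
    termCode_injective Subtype.val_injective
  constructor
  · intro s t
    rw [eq_mem_atomicDiagram_iff, eq_mem_atomicDiagram_iff]
    rintro ⟨σ, τ, h₁, h₂, h⟩
    exact ⟨τ, σ, h₂, h₁, h.symm⟩
  · intro s t r
    rw [eq_mem_atomicDiagram_iff, eq_mem_atomicDiagram_iff, eq_mem_atomicDiagram_iff]
    rintro ⟨σ, τ, h₁, h₂, h⟩ ⟨τ', ρ, h₃, h₄, h'⟩
    rw [inj (h₃.trans h₂.symm)] at h'
    exact ⟨σ, ρ, h₁, h₄, h.trans h'⟩
  · intro s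
    rw [self_mem_atomicDiagram_iff]
    rintro ⟨σ, h⟩
    exact ⟨(σ.realize id : A), eq_mem_atomicDiagram_iff.2 ⟨σ, .var (σ.realize id), h, rfl, rfl⟩⟩
  · intro a b
    rw [eq_mem_atomicDiagram_iff]
    rintro ⟨σ, τ, h₁, h₂, h⟩
    obtain ⟨x, rfl, rfl⟩ := const_of_termCode h₁
    obtain ⟨y, rfl, rfl⟩ := const_of_termCode h₂
    exact congrArg Subtype.val h
  · exact self_mem_atomicDiagram_iff.2 ⟨tZero, termCode_tZero _⟩
  · intro s
    rw [self_mem_atomicDiagram_iff, self_mem_atomicDiagram_iff]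
    rintro ⟨σ, h⟩
    exact neg_of_termCode h
  · intro s t
    rw [self_mem_atomicDiagram_iff, self_mem_atomicDiagram_iff, self_mem_atomicDiagram_iff]
    rintro ⟨σ, h⟩
    exact add_of_termCode h
  · intro s t
    rw [eq_mem_atomicDiagram_iff, eq_mem_atomicDiagram_iff]
    rintro ⟨σ, τ, rfl, rfl, h⟩
    exact ⟨tNeg σ, tNeg τ, termCode_tNeg _ _, termCode_tNeg _ _, realize_tNeg_congr h⟩
  · intro s s' t t'
    rw [eq_mem_atomicDiagram_iff, eq_mem_atomicDiagram_iff, eq_mem_atomicDiagram_iff]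
    rintro ⟨σ, σ', rfl, rfl, h⟩ ⟨τ, τ', rfl, rfl, h'⟩
    exact ⟨tAdd σ τ, tAdd σ' τ', termCode_tAdd _ _ _, termCode_tAdd _ _ _, realize_tAdd_congr h h'⟩
  · intro s t
    rw [self_mem_atomicDiagram_iff, self_mem_atomicDiagram_iff]
    rintro ⟨σ, rfl⟩ ⟨τ, rfl⟩
    by_cases h : σ.realize id = τ.realize id
    · exact Or.inl (eq_mem_atomicDiagram_iff.2 ⟨σ, τ, rfl, rfl, h⟩)
    · exact Or.inr (ne_mem_atomicDiagram_iff.2 ⟨σ, τ, rfl, rfl, h⟩)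
  · intro s t
    rw [ne_mem_atomicDiagram_iff, self_mem_atomicDiagram_iff, self_mem_atomicDiagram_iff]
    rintro ⟨σ, τ, h₁, h₂, -⟩
    exact ⟨⟨σ, h₁⟩, τ, h₂⟩
  · intro s t
    rw [eq_mem_atomicDiagram_iff, ne_mem_atomicDiagram_iff]
    rintro ⟨σ, τ, rfl, rfl, h⟩ ⟨σ', τ', h₁, h₂, h'⟩
    rw [inj h₁, inj h₂] at h'
    exact h' h
  · rintro n ⟨s, t, φ, rfl | rfl, -, rfl⟩ <;> simp only [QF.code] <;> omega

end Diagram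

theorem IsDiagram.exists_structure {X : Set ℕ} (h : IsDiagram X) :
    ∃ (A : Set ℕ) (_ : grpLang.Structure A), X = atomicDiagram A := by
  let A : Set ℕ := {a | 4 * Nat.pair (3 * a + 1) (3 * a + 1) ∈ X}
  have hl : ∀ {s t}, 4 * Nat.pair s t ∈ X → 4 * Nat.pair s s ∈ X := fun h₁ =>
    h.trans _ _ _ h₁ (h.symm _ _ h₁)
  have hr : ∀ {s t}, 4 * Nat.pair s t ∈ X → 4 * Nat.pair t t ∈ X := fun h₁ => hl (h.symm _ _ h₁)
  have hval : ∀ s, 4 * Nat.pair s s ∈ X → ∃ a : A, 4 * Nat.pair s (3 * a.1 + 1) ∈ X := fun s hs =>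
    (h.val s hs).elim fun a ha => ⟨⟨a, hr ha⟩, ha⟩
  obtain ⟨z, hz⟩ := hval 0 h.zero
  choose n hn using fun x : A => hval _ (h.neg_congr _ _ x.2)
  choose p hp using fun x y : A => hval _ (h.add_congr _ _ _ _ x.2 y.2)
  let S : grpLang.Structure A :=
    { funMap := fun {_} f x =>
        match f, x with
        | GrpFunc.e, _ => z
        | GrpFunc.inv, x => n (x 0)
        | GrpFunc.op, x => p (x 0) (x 1)
      RelMap := fun r _ => Empty.elim r }
  have key : ∀ τ : grpLang.Term A,
      4 * Nat.pair (termCode Subtype.val τ) (3 * (τ.realize id : A).1 + 1) ∈ X := by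
    intro τ
    induction τ with
    | var a => exact a.2
    | func f ts ih =>
      match f, ts, ih with
      | GrpFunc.e, ts, ih => exact hz
      | GrpFunc.inv, ts, ih => exact h.trans _ _ _ (h.neg_congr _ _ (ih 0)) (hn _)
      | GrpFunc.op, ts, ih => exact h.trans _ _ _ (h.add_congr _ _ _ _ (ih 0) (ih 1)) (hp _ _)
  have hterm : ∀ s, 4 * Nat.pair s s ∈ X → ∃ τ : grpLang.Term A, termCode Subtype.val τ = s := by
    intro s
    induction s using Nat.strong_induction_on with
    | _ s ih =>
      intro hs
      obtain rfl | ⟨a, rfl⟩ | ⟨a, rfl⟩ | ⟨a, rfl⟩ : s = 0 ∨ (∃ a, s = 3 * a + 1) ∨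
          (∃ a, s = 3 * a + 2) ∨ ∃ a, s = 3 * a + 3 := by
        obtain h | h | h : s % 3 = 0 ∨ s % 3 = 1 ∨ s % 3 = 2 := by omega
        · rcases Nat.eq_zero_or_pos s with h' | h'
          · exact Or.inl h'
          · exact Or.inr (Or.inr (Or.inr ⟨s / 3 - 1, by omega⟩))
        · exact Or.inr (Or.inl ⟨s / 3, by omega⟩)
        · exact Or.inr (Or.inr (Or.inl ⟨s / 3, by omega⟩))
      · exact ⟨tZero, termCode_tZero _⟩
      · exact ⟨.var ⟨a, hs⟩, rfl⟩
      · obtain ⟨τ, rfl⟩ := ih a (by omega) (h.neg_dom _ hs)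
        exact ⟨tNeg τ, termCode_tNeg _ _⟩
      · rw [← Nat.pair_unpair a] at hs
        have h₁ := Nat.unpair_left_le a
        have h₂ := Nat.unpair_right_le a
        obtain ⟨τ, hτ⟩ := ih a.unpair.1 (by omega) (h.add_dom _ _ hs).1
        obtain ⟨σ, hσ⟩ := ih a.unpair.2 (by omega) (h.add_dom _ _ hs).2
        exact ⟨tAdd τ σ, by rw [termCode_tAdd, hτ, hσ, Nat.pair_unpair]⟩
  have heq : ∀ σ τ : grpLang.Term A, 4 * Nat.pair (termCode Subtype.val σ)
      (termCode Subtype.val τ) ∈ X ↔ σ.realize id = τ.realize id := by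
    intro σ τ
    constructor
    · intro h₁
      exact Subtype.ext (h.const _ _ (h.trans _ _ _ (h.symm _ _ (key σ)) (h.trans _ _ _ h₁ (key τ))))
    · intro h₁
      have := key σ
      rw [h₁] at this
      exact h.trans _ _ _ this (h.symm _ _ (key τ))
  refine ⟨A, S, Set.ext fun m => ⟨fun hm => ?_, ?_⟩⟩
  · rcases h.atomic m hm with h₁ | h₁
    · obtain ⟨s, t, rfl⟩ : ∃ s t, m = 4 * Nat.pair s t :=
        ⟨(m / 4).unpair.1, (m / 4).unpair.2, by rw [Nat.pair_unpair]; omega⟩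
      obtain ⟨σ, rfl⟩ := hterm s (hl hm)
      obtain ⟨τ, rfl⟩ := hterm t (hr hm)
      exact eq_mem_atomicDiagram_iff.2 ⟨σ, τ, rfl, rfl, (heq σ τ).1 hm⟩
    · obtain ⟨s, t, rfl⟩ : ∃ s t, m = 4 * Nat.pair s t + 1 :=
        ⟨(m / 4).unpair.1, (m / 4).unpair.2, by rw [Nat.pair_unpair]; omega⟩
      obtain ⟨σ, rfl⟩ := hterm s (h.ne_dom _ _ hm).1
      obtain ⟨τ, rfl⟩ := hterm t (h.ne_dom _ _ hm).2
      exact ne_mem_atomicDiagram_iff.2 ⟨σ, τ, rfl, rfl, fun h₂ => h.consistent _ _ ((heq σ τ).2 h₂) hm⟩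
  · rintro ⟨σ, τ, φ, rfl | rfl, h₁, rfl⟩
    · exact (heq σ τ).2 h₁
    · exact (h.total _ _ (hl (key σ)) (hl (key τ))).resolve_left fun h₂ => h₁ ((heq σ τ).1 h₂)

/-! ## The index set is `d-Σ⁰₂` -/

/-- The condition on the atomic diagram that corresponds to `PiSat`. -/
def PiDiag (M : ℕ) (X : Set ℕ) : Prop :=
  ∀ j n x y z, 4 * Nat.pair (3 * x + 1) (3 * x + 1) ∈ X →
    4 * Nat.pair (3 * y + 1) (3 * y + 1) ∈ X → 4 * Nat.pair (3 * z + 1) (3 * z + 1) ∈ X →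
    ∃ c a m w, litCode M j n c a m x y z w ∈ X ∧ 4 * Nat.pair (3 * w + 1) (3 * w + 1) ∈ X

/-- The condition on the atomic diagram that corresponds to `SigmaSat`. -/
def SigmaDiag (q : ℕ → ℕ) (X : Set ℕ) : Prop :=
  ∃ x, 4 * Nat.pair (3 * x + 1) (3 * x + 1) ∈ X ∧ ∀ n y,
    4 * Nat.pair (3 * y + 1) (3 * y + 1) ∈ X →
      4 * Nat.pair (mulCode (3 * y + 1) (q n)) (3 * x + 1) ∉ X

theorem isPi02_piDiag (M : ℕ) : IsPi02 {e | PiDiag M (posSet e)} := by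
  have h := isPi02_horn (α := ℕ × ℕ × ℕ × ℕ × ℕ) (β := ℕ × ℕ × ℕ × ℕ)
    (g₁ := fun x => 4 * Nat.pair (3 * x.2.2.1 + 1) (3 * x.2.2.1 + 1))
    (g₂ := fun x => 4 * Nat.pair (3 * x.2.2.2.1 + 1) (3 * x.2.2.2.1 + 1))
    (g₃ := fun x => 4 * Nat.pair (3 * x.2.2.2.2 + 1) (3 * x.2.2.2.2 + 1))
    (P := fun _ => false)
    (h₁ := fun x => litCode M x.1.1 x.1.2.1 x.2.1 x.2.2.1 x.2.2.2.1 x.1.2.2.1 x.1.2.2.2.1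
      x.1.2.2.2.2 x.2.2.2.2)
    (h₂ := fun x => 4 * Nat.pair (3 * x.2.2.2.2 + 1) (3 * x.2.2.2.2 + 1))
    (by fun_prop) (by fun_prop) (by fun_prop) (by fun_prop) (by fun_prop) (by fun_prop)
  simpa only [PiDiag, Prod.forall, Prod.exists, Bool.false_eq_true, false_or] using h

theorem isSigma02_sigmaDiag {q : ℕ → ℕ} (hq : Computable q) :
    IsSigma02 {e | SigmaDiag q (posSet e)} := by
  have h := isSigma02_of_denumerable (α := ℕ × ℕ) (β := ℕ × ℕ × ℕ × ℕ)
    (R := fun p => stageEval 1 p.2.1.2 p.1 (4 * Nat.pair (3 * p.2.1.1 + 1) (3 * p.2.1.1 + 1)) &&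
      !(stageEval 1 p.2.2.2.2.1 p.1 (4 * Nat.pair (3 * p.2.2.2.1 + 1) (3 * p.2.2.2.1 + 1)) &&
        stageEval 1 p.2.2.2.2.2 p.1
          (4 * Nat.pair (mulCode (3 * p.2.2.2.1 + 1) (q p.2.2.1)) (3 * p.2.1.1 + 1)))) (by fun_prop)
  convert h using 1
  ext e
  simp only [SigmaDiag, Set.mem_ofPred_eq, mem_posSet_iff, Prod.exists, Prod.forall,
    Bool.and_eq_true, Bool.not_eq_true', Bool.and_eq_false_iff]
  constructor
  · rintro ⟨x, ⟨s, hs⟩, h⟩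
    refine ⟨x, s, fun n y s₁ s₂ => ⟨hs, ?_⟩⟩
    by_contra! hc
    simp only [ne_eq, Bool.not_eq_false] at hc
    exact h n y ⟨_, hc.1⟩ ⟨_, hc.2⟩
  · rintro ⟨x, s, h⟩
    refine ⟨x, ⟨s, (h 0 0 0 0).1⟩, ?_⟩
    rintro n y ⟨s₁, h₁⟩ ⟨s₂, h₂⟩
    simpa [h₁, h₂] using (h n y s₁ s₂).2

theorem lit_eq_or_ne {α : Type} (M j n c a m : ℕ) (x y z w : α) :
    ∃ s t, lit M j n c a m x y z w = .eq s t ∨ lit M j n c a m x y z w = .ne s t := by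
  have h : ∀ (b : Bool) (φ ψ : QF α), (∃ s t, φ = .eq s t ∨ φ = .ne s t) →
      (∃ s t, ψ = .eq s t ∨ ψ = .ne s t) →
        ∃ s t, (bif b then φ else ψ) = .eq s t ∨ (bif b then φ else ψ) = .ne s t := by
    rintro (_ | _) φ ψ h h'
    · exact h'
    · exact h
  unfold lit
  repeat' apply h
  all_goals first
    | exact ⟨_, _, Or.inl rfl⟩
    | exact ⟨_, _, Or.inr rfl⟩

section

variable {A : Set ℕ} [grpLang.Structure A]

theorem code_mem_atomicDiagram_iff {φ : QF A} {s t : grpLang.Term A} (h : φ = .eq s t ∨ φ = .ne s t) :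
    φ.code Subtype.val ∈ atomicDiagram A ↔ φ.Realize id := by
  constructor
  · rintro ⟨s, t, ψ, -, h, hc⟩
    rwa [QF.code_injective Subtype.val_injective hc]
  · intro h'
    exact ⟨s, t, φ, h, h', rfl⟩

theorem piSat_iff_piDiag (M : ℕ) : PiSat M A ↔ PiDiag M (atomicDiagram A) := by
  have key : ∀ j n c a m (x y z w : A), (lit M j n c a m x y z w).Realize id ↔
      litCode M j n c a m x y z w ∈ atomicDiagram A := by
    intro j n c a m x y z w
    obtain ⟨s, t, h⟩ := lit_eq_or_ne M j n c a m x y z w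
    rw [← code_mem_atomicDiagram_iff h, code_lit]
  simp only [PiDiag, const_mem_atomicDiagram_iff, PiSat, key]
  constructor
  · intro h j n x y z hx hy hz
    obtain ⟨c, a, m, w, h⟩ := h j n ⟨x, hx⟩ ⟨y, hy⟩ ⟨z, hz⟩
    exact ⟨c, a, m, w, h, w.2⟩
  · intro h j n x y z
    obtain ⟨c, a, m, w, h, hw⟩ := h j n x y z x.2 y.2 z.2
    exact ⟨c, a, m, ⟨w, hw⟩, h⟩

theorem sigmaSat_iff_sigmaDiag (q : ℕ → ℕ) : SigmaSat q A ↔ SigmaDiag q (atomicDiagram A) := by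
  have key : ∀ n (x y : A), (litNe n x y).Realize id ↔
      4 * Nat.pair (mulCode (3 * y.1 + 1) n) (3 * x.1 + 1) ∉ atomicDiagram A := by
    intro n x y
    have h := code_mem_atomicDiagram_iff (A := A) (φ := .eq (tMul (.var y) n) (.var x)) (Or.inl rfl)
    simp only [QF.code, termCode_tMul, termCode] at h
    rw [h]
    rfl
  simp only [SigmaDiag, const_mem_atomicDiagram_iff, SigmaSat, key]
  constructor
  · rintro ⟨x, h⟩
    exact ⟨x, x.2, fun n y hy => h n ⟨y, hy⟩⟩
  · rintro ⟨x, hx, h⟩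
    exact ⟨⟨x, hx⟩, fun n y => h n y y.2⟩

end

theorem isPi02_total : IsPi02 {e | ∀ n, 0 ∈ phi e n ∨ 1 ∈ phi e n} := by
  have h := isPi02_of_denumerable (α := ℕ) (β := ℕ) (R := fun p => stageEval 0 p.2.2 p.1 p.2.1 ||
    stageEval 1 p.2.2 p.1 p.2.1) (by fun_prop)
  convert h using 1
  ext e
  simp only [Set.mem_ofPred_eq, mem_phi_iff, Bool.or_eq_true, exists_or]

theorem phi_eq_indicator_iff {e : ℕ} {X : Set ℕ} [∀ n, Decidable (n ∈ X)] :
    (∀ n, phi e n = Part.some (if n ∈ X then 1 else 0)) ↔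
      (∀ n, 0 ∈ phi e n ∨ 1 ∈ phi e n) ∧ posSet e = X := by
  constructor
  · intro h
    refine ⟨fun n => ?_, Set.ext fun n => ?_⟩
    · rw [h n]
      by_cases hn : n ∈ X <;> simp [hn]
    · change 1 ∈ phi e n ↔ _
      rw [h n]
      by_cases hn : n ∈ X <;> simp [hn]
  · rintro ⟨h, rfl⟩ n
    by_cases hn : n ∈ posSet e
    · rw [if_pos hn]
      exact Part.eq_some_iff.2 hn
    · rw [if_neg hn]
      exact Part.eq_some_iff.2 ((h n).resolve_right hn)

theorem grpIso_iff_diag {G : AddSubgroup ℚ} {M : ℕ} {q : ℕ → ℕ} (hM : M ≠ 0)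
    (hq : ∀ n, (q n).Prime ∧ q n ∣ M) (hq' : ∀ p, p.Prime → p ∣ M → ∃ n, q n = p)
    (hG : IsLoc M q G) (A : Set ℕ) [grpLang.Structure A] :
    GrpIso A G ↔ PiDiag M (atomicDiagram A) ∧ SigmaDiag q (atomicDiagram A) := by
  rw [← piSat_iff_piDiag, ← sigmaSat_iff_sigmaDiag]
  have hG' := (G.compat.isLoc_iff M q).1 hG
  exact ⟨fun h => ⟨hG'.1.of_grpIso h.symm, hG'.2.of_grpIso h.symm⟩,
    fun h => grpIso_of_sat hq hq' hM h hG'⟩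

theorem mem_indexSet_iff {G : AddSubgroup ℚ} {M : ℕ} {q : ℕ → ℕ} (hM : M ≠ 0)
    (hq : ∀ n, (q n).Prime ∧ q n ∣ M) (hq' : ∀ p, p.Prime → p ∣ M → ∃ n, q n = p)
    (hG : IsLoc M q G) (e : ℕ) : e ∈ indexSet G ↔ (∀ n, 0 ∈ phi e n ∨ 1 ∈ phi e n) ∧
      IsDiagram (posSet e) ∧ PiDiag M (posSet e) ∧ SigmaDiag q (posSet e) := by
  classical
  constructor
  · rintro ⟨A, _, h, hA⟩
    rw [grpIso_iff_diag hM hq hq' hG] at hA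
    obtain ⟨h₁, h₂⟩ := phi_eq_indicator_iff.1 h
    rw [h₂]
    exact ⟨h₁, isDiagram_atomicDiagram A, hA⟩
  · rintro ⟨h₁, h₂, h₃⟩
    obtain ⟨A, _, h⟩ := h₂.exists_structure
    rw [h, ← grpIso_iff_diag hM hq hq' hG] at h₃
    refine ⟨A, _, ?_, h₃⟩
    convert phi_eq_indicator_iff.2 ⟨h₁, h⟩

theorem isDSigma02_indexSet {G : AddSubgroup ℚ} {M : ℕ} {q : ℕ → ℕ} (hM : M ≠ 0)
    (hq : ∀ n, (q n).Prime ∧ q n ∣ M) (hq' : ∀ p, p.Prime → p ∣ M → ∃ n, q n = p)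
    (hqc : Computable q) (hG : IsLoc M q G) : IsDSigma02 (indexSet G) := by
  refine ⟨_, _, isSigma02_sigmaDiag hqc,
    (isPi02_total.inter (isPi02_isDiagram.inter (isPi02_piDiag M))).compl, ?_⟩
  ext e
  rw [mem_indexSet_iff hM hq hq' hG]
  simp only [Set.mem_sdiff, Set.mem_compl_iff, not_not, Set.mem_inter_iff, Set.mem_ofPred_eq]
  tauto

/-! ## Counters for `Σ⁰₂` sets -/

/-- A pointer `(x, y)` that moves to `(x, y + 1)` as long as `R (n, x, y)` holds, and
to `(x + 1, 0)` when this fails. -/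
def pointer (R : ℕ × ℕ × ℕ → Bool) (n s : ℕ) : ℕ × ℕ :=
  Nat.rec (0, 0) (fun _ p => bif R (n, p) then (p.1, p.2 + 1) else (p.1 + 1, 0)) s

theorem pointer_succ (R : ℕ × ℕ × ℕ → Bool) (n s : ℕ) : pointer R n (s + 1) =
    bif R (n, pointer R n s) then ((pointer R n s).1, (pointer R n s).2 + 1)
    else ((pointer R n s).1 + 1, 0) := rfl

theorem computable_pointer {R : ℕ × ℕ × ℕ → Bool} (hR : Computable R) :
    Computable fun p : ℕ × ℕ => pointer R p.1 p.2 := by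
  have := Computable.fun_natRec (α := ℕ × ℕ) (f := fun p => p.2) (g := fun _ => ((0, 0) : ℕ × ℕ))
    (h := fun p => bif R (p.1.1, p.2.2) then (p.2.2.1, p.2.2.2 + 1) else (p.2.2.1 + 1, 0))
    (by fun_prop) (by fun_prop) (by fun_prop)
  exact this

theorem pointer_monotone (R : ℕ × ℕ × ℕ → Bool) (n : ℕ) : Monotone fun s => (pointer R n s).1 := by
  refine monotone_nat_of_le_succ fun s => ?_
  rw [pointer_succ]
  cases R (n, pointer R n s) <;> simp

theorem pointer_spec (R : ℕ × ℕ × ℕ → Bool) (n s : ℕ) :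
    ∀ y < (pointer R n s).2, R (n, (pointer R n s).1, y) = true := by
  induction s with
  | zero => intro y hy; exact absurd hy (Nat.not_lt_zero y)
  | succ s ih =>
    rw [pointer_succ]
    cases h : R (n, pointer R n s) with
    | false => intro y hy; exact absurd hy (Nat.not_lt_zero y)
    | true =>
      intro y hy
      rcases Nat.lt_succ_iff_lt_or_eq.1 hy with hy | rfl
      · exact ih y hy
      · exact h

theorem exists_forall_le_of_bounded {a : ℕ → ℕ} (h : ∃ B, ∀ s, a s ≤ B) : ∃ t, ∀ s, a s ≤ a t := by
  obtain ⟨B, hB⟩ := h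
  have hb : BddAbove (Set.range a) := ⟨B, by rintro _ ⟨s, rfl⟩; exact hB s⟩
  obtain ⟨t, ht⟩ := Nat.sSup_mem (Set.range_nonempty a) hb
  exact ⟨t, fun s => ht ▸ le_csSup hb ⟨s, rfl⟩⟩

theorem IsSigma02.exists_counter {S : Set ℕ} (hS : IsSigma02 S) : ∃ a : ℕ → ℕ → ℕ,
    Computable (fun p : ℕ × ℕ => a p.1 p.2) ∧ (∀ n, Monotone (a n)) ∧
      ∀ n, n ∈ S ↔ ∃ B, ∀ s, a n s ≤ B := by
  obtain ⟨R', ⟨_, hR⟩, h⟩ := hS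
  let R : ℕ × ℕ × ℕ → Bool := fun p => decide (R' p)
  have hRR : ∀ p, R p = true ↔ R' p := fun p => decide_eq_true_iff
  refine ⟨fun n s => (pointer R n s).1, Computable.fst.comp (computable_pointer hR),
    pointer_monotone R, fun n => ?_⟩
  rw [h]
  constructor
  · rintro ⟨x, hx⟩
    refine ⟨x, fun s => ?_⟩
    induction s with
    | zero => exact Nat.zero_le x
    | succ s ih =>
      beta_reduce
      rw [pointer_succ]
      cases h : R (n, pointer R n s) with
      | true => exact ih
      | false =>
        refine lt_of_le_of_ne ih fun hc => ?_
        have := (hRR _).2 (hx (pointer R n s).2)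
        rw [← hc, h] at this
        exact Bool.false_ne_true this
  · intro hb
    obtain ⟨t, ht⟩ := exists_forall_le_of_bounded hb
    have hconst : ∀ k, (pointer R n (t + k)).1 = (pointer R n t).1 := fun k =>
      le_antisymm (ht _) (pointer_monotone R n (Nat.le_add_right t k))
    have hsnd : ∀ k, k ≤ (pointer R n (t + k)).2 := by
      intro k
      induction k with
      | zero => exact Nat.zero_le _
      | succ k ih =>
        have h₁ := hconst (k + 1)
        rw [← hconst k, ← add_assoc, pointer_succ] at h₁
        rw [← add_assoc, pointer_succ]
        cases h : R (n, pointer R n (t + k)) with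
        | true => exact Nat.succ_le_succ ih
        | false =>
          rw [h] at h₁
          exact absurd h₁ (Nat.succ_ne_self _)
    refine ⟨(pointer R n t).1, fun y => (hRR _).1 ?_⟩
    rw [← hconst (y + 1)]
    exact pointer_spec R n _ y (hsnd (y + 1))

/-! ## Unions of chains of cyclic groups -/

/-- The union of the groups `(1 / N s) ℤ`. -/
def unionGroup (N : ℕ → ℕ) (hN : ∀ s t, s ≤ t → N s ∣ N t) : AddSubgroup ℚ where
  carrier := {r | ∃ (s : ℕ) (m : ℤ), r * N s = m}
  zero_mem' := ⟨0, 0, by simp⟩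
  neg_mem' := by
    rintro r ⟨s, m, h⟩
    exact ⟨s, -m, by rw [neg_mul, h]; simp⟩
  add_mem' := by
    rintro r r' ⟨s, m, h⟩ ⟨s', m', h'⟩
    obtain ⟨k, hk⟩ := hN s (max s s') (le_max_left _ _)
    obtain ⟨k', hk'⟩ := hN s' (max s s') (le_max_right _ _)
    refine ⟨max s s', m * k + m' * k', ?_⟩
    rw [add_mul]
    nth_rewrite 1 [hk]
    rw [hk']
    push_cast
    rw [← mul_assoc, h, ← mul_assoc, h']

/-- The common denominator at a stage with counters `a` and `b`. -/
def stageDen (M a b : ℕ) : ℕ := M ^ a * ∏ i ∈ Finset.range b, (i * M + 1)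

theorem stageDen_pos {M : ℕ} (hM : M ≠ 0) (a b : ℕ) : 0 < stageDen M a b :=
  Nat.mul_pos (pow_pos (Nat.pos_of_ne_zero hM) a) (Finset.prod_pos fun _ _ => Nat.succ_pos _)

theorem stageDen_dvd (M : ℕ) {a a' b b' : ℕ} (ha : a ≤ a') (hb : b ≤ b') :
    stageDen M a b ∣ stageDen M a' b' :=
  mul_dvd_mul (pow_dvd_pow M ha)
    (Finset.prod_dvd_prod_of_subset _ _ _ (Finset.range_subset_range.2 hb))

theorem isLoc_unionGroup_iff {M : ℕ} {q : ℕ → ℕ} (hM : M ≠ 0) (hq : ∀ n, (q n).Prime ∧ q n ∣ M)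
    {a b : ℕ → ℕ} (ha : Monotone a) (hb : Monotone b) :
    IsLoc M q (unionGroup (fun s => stageDen M (a s) (b s))
      fun _ _ h => stageDen_dvd M (ha h) (hb h)) ↔
      (∃ B, ∀ s, a s ≤ B) ∧ ¬ ∃ B, ∀ s, b s ≤ B := by
  rw [AddSubgroup.isLoc_iff]
  have hMQ : (M : ℚ) ≠ 0 := by exact_mod_cast hM
  have hprod : ∀ b : ℕ, ((∏ i ∈ Finset.range b, (i * M + 1) : ℕ) : ℚ) ≠ 0 := fun b => by
    exact_mod_cast (Finset.prod_pos fun i _ => Nat.succ_pos (i * M)).ne'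
  constructor
  · rintro ⟨hdiv, ⟨x, s, m, hx⟩, hgen⟩
    constructor
    · by_contra! hc
      obtain ⟨t, ht⟩ := hc (a s)
      have hst : s ≤ t := le_of_not_gt fun h => absurd (ha h.le) (not_le.2 ht)
      obtain ⟨k, hk⟩ : q 0 * stageDen M (a s) (b s) ∣ stageDen M (a t) (b t) := by
        refine dvd_trans ?_ (stageDen_dvd M ht (hb hst))
        rw [stageDen, stageDen, pow_succ', mul_assoc]
        exact mul_dvd_mul_right (hq 0).2 _
      have hp : (q 0 : ℚ) ≠ 0 := by exact_mod_cast (hq 0).1.ne_zero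
      refine hgen 0 ⟨x / q 0, t, m * k, ?_⟩ (Subtype.ext ?_)
      · beta_reduce at hx ⊢
        rw [hk]
        push_cast
        rw [← hx]
        field_simp
      · simp only [AddSubgroup.coe_nsmul, nsmul_eq_mul]
        field_simp
    · intro hc
      obtain ⟨s, hs⟩ := exists_forall_le_of_bounded hc
      obtain ⟨⟨w, t, m, hw⟩, hw'⟩ := hdiv 1 ⟨1 / (∏ i ∈ Finset.range (b s), (i * M + 1) : ℕ), s,
        (M : ℤ) ^ a s, by
          beta_reduce
          rw [stageDen, Nat.cast_mul, one_div, mul_comm, mul_assoc, mul_inv_cancel₀ (hprod _)]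
          push_cast; ring⟩
      beta_reduce at hw
      have hw' := congrArg Subtype.val hw'
      simp only [AddSubgroup.coe_nsmul, nsmul_eq_mul, one_mul] at hw'
      obtain ⟨c, hc⟩ := Finset.prod_dvd_prod_of_subset _ _ (fun i => i * M + 1)
        (Finset.range_subset_range.2 (hs t))
      rw [eq_div_iff (hprod _)] at hw'
      have h₁ : ((M + 1 : ℕ) : ℤ) * (m * c) = ((M ^ a t : ℕ) : ℤ) := by
        have h₂ : ((M + 1 : ℕ) : ℚ) * (m * c) = ((M ^ a t : ℕ) : ℚ) := by
          rw [← hw, stageDen, Nat.cast_mul]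
          rw [hc, Nat.cast_mul] at hw'
          linear_combination ((M ^ a t : ℕ) : ℚ) * hw'
        exact_mod_cast h₂
      have h₃ : M + 1 ∣ M ^ a t := Int.natCast_dvd_natCast.1 ⟨_, h₁.symm⟩
      have h₄ : Nat.Coprime (M + 1) (M ^ a t) := Nat.Coprime.pow_right _ (by simp)
      have := Nat.eq_one_of_dvd_coprimes h₄ dvd_rfl h₃
      omega
  · rintro ⟨hbd, hub⟩
    push Not at hub
    constructor
    · rintro n ⟨x, s, m, hx⟩
      obtain ⟨t, ht⟩ := hub (n * (b s * M + 1) + b s)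
      have hst : s ≤ t := le_of_not_gt fun h => by
        have := hb h.le
        omega
      obtain ⟨k, hk⟩ : (n * M + 1) * stageDen M (a s) (b s) ∣ stageDen M (a t) (b t) := by
        rw [stageDen, stageDen, mul_left_comm]
        refine mul_dvd_mul (pow_dvd_pow M (ha hst)) ?_
        rw [← Finset.prod_range_mul_prod_Ico _ (hb hst), mul_comm]
        refine mul_dvd_mul_left _ (dvd_trans ⟨b s * M + 1, ?_⟩ (Finset.dvd_prod_of_mem _
          (Finset.mem_Ico.2 ⟨Nat.le_add_left (b s) (n * (b s * M + 1)), ht⟩)))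
        ring
      have hn : ((n * M + 1 : ℕ) : ℚ) ≠ 0 := by exact_mod_cast (n * M).succ_ne_zero
      refine ⟨⟨x / (n * M + 1 : ℕ), t, m * k, ?_⟩, Subtype.ext ?_⟩
      · beta_reduce at hx ⊢
        rw [hk]
        push_cast
        rw [← hx]
        push_cast at hn
        field_simp
      · simp only [AddSubgroup.coe_nsmul, nsmul_eq_mul]
        field_simp
    · obtain ⟨s, hs⟩ := exists_forall_le_of_bounded hbd
      refine ⟨⟨1 / (M ^ a s : ℚ), s, (∏ i ∈ Finset.range (b s), (i * M + 1) : ℕ), ?_⟩, ?_⟩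
      · beta_reduce
        rw [stageDen, Nat.cast_mul, Nat.cast_pow]
        field_simp
        push_cast
        rfl
      · rintro n ⟨y, t, m, hy⟩ h
        beta_reduce at hy
        have h := congrArg Subtype.val h
        simp only [AddSubgroup.coe_nsmul, nsmul_eq_mul] at h
        rw [eq_div_iff (pow_ne_zero _ hMQ)] at h
        have h₁ : (q n : ℤ) * (m * (M : ℤ) ^ (a s - a t)) =
            ((∏ i ∈ Finset.range (b t), (i * M + 1) : ℕ) : ℤ) := by
          have h₂ : (q n : ℚ) * (m * (M : ℚ) ^ (a s - a t)) =
              ((∏ i ∈ Finset.range (b t), (i * M + 1) : ℕ) : ℚ) := by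
            have h₃ : (M : ℚ) ^ a s = M ^ a t * M ^ (a s - a t) := by
              rw [← pow_add, Nat.add_sub_cancel' (hs t)]
            rw [← hy, stageDen, Nat.cast_mul, Nat.cast_pow]
            rw [h₃] at h
            linear_combination ((∏ i ∈ Finset.range (b t), (i * M + 1) : ℕ) : ℚ) * h
          exact_mod_cast h₂
        have h₄ : q n ∣ ∏ i ∈ Finset.range (b t), (i * M + 1) :=
          Int.natCast_dvd_natCast.1 ⟨_, h₁.symm⟩
        obtain ⟨i, -, hi⟩ := (Prime.dvd_finsetProd_iff (hq n).1.prime _).1 h₄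
        have := (Nat.dvd_add_right ((hq n).2.mul_left i)).1 hi
        exact (hq n).1.one_lt.ne' (Nat.dvd_one.1 this)

/-! ## Computable copies of subgroups of `ℚ` -/

namespace Computable

variable {α β : Type*} [Primcodable α] [Primcodable β]

@[fun_prop]
theorem fun_getElem?_getD {f : α → List β} {g : α → ℕ} (d : β) (hf : Computable f)
    (hg : Computable g) : Computable fun x => ((f x)[g x]?).getD d :=
  Computable.option_getD (Computable.list_getElem?.comp hf hg) (Computable.const d)

@[fun_prop]
theorem fun_length {f : α → List β} (hf : Computable f) : Computable fun x => (f x).length :=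
  Computable.list_length.comp hf

end Computable

/-- The rational number represented by a triple of natural numbers. -/
def tripleRat (t : ℕ × ℕ × ℕ) : ℚ := (t.1 - t.2.1) / (t.2.2 + 1)

/-- The sum of two rational numbers represented by triples. -/
def tripleAdd (t t' : ℕ × ℕ × ℕ) : ℕ × ℕ × ℕ :=
  (t.1 * (t'.2.2 + 1) + t'.1 * (t.2.2 + 1), t.2.1 * (t'.2.2 + 1) + t'.2.1 * (t.2.2 + 1),
    t.2.2 * t'.2.2 + t.2.2 + t'.2.2)

/-- The negative of a rational number represented by a triple. -/
def tripleNeg (t : ℕ × ℕ × ℕ) : ℕ × ℕ × ℕ := (t.2.1, t.1, t.2.2)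

/-- Equality of the rational numbers represented by triples. -/
def tripleEq (t t' : ℕ × ℕ × ℕ) : Bool :=
  t.1 * (t'.2.2 + 1) + t'.2.1 * (t.2.2 + 1) == t'.1 * (t.2.2 + 1) + t.2.1 * (t'.2.2 + 1)

theorem tripleRat_add (t t' : ℕ × ℕ × ℕ) :
    tripleRat (tripleAdd t t') = tripleRat t + tripleRat t' := by
  have h : (t.2.2 + 1 : ℚ) ≠ 0 := by positivity
  have h' : (t'.2.2 + 1 : ℚ) ≠ 0 := by positivity
  rw [tripleRat, tripleRat, tripleRat, div_add_div _ _ h h']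
  simp only [tripleAdd]
  push_cast
  congr 1 <;> ring

theorem tripleRat_neg (t : ℕ × ℕ × ℕ) : tripleRat (tripleNeg t) = -tripleRat t := by
  rw [tripleRat, tripleRat, ← neg_div]
  simp [tripleNeg]

theorem tripleEq_iff (t t' : ℕ × ℕ × ℕ) : tripleEq t t' = true ↔ tripleRat t = tripleRat t' := by
  have h : (t.2.2 + 1 : ℚ) ≠ 0 := by positivity
  have h' : (t'.2.2 + 1 : ℚ) ≠ 0 := by positivity
  rw [tripleEq, beq_iff_eq, tripleRat, tripleRat, div_eq_div_iff h h']
  have : t.1 * (t'.2.2 + 1) + t'.2.1 * (t.2.2 + 1) = t'.1 * (t.2.2 + 1) + t.2.1 * (t'.2.2 + 1) ↔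
      (t.1 * (t'.2.2 + 1) + t'.2.1 * (t.2.2 + 1) : ℚ) =
        t'.1 * (t.2.2 + 1) + t.2.1 * (t'.2.2 + 1) := by exact_mod_cast Iff.rfl
  rw [this]
  constructor <;> intro h <;> linarith

@[fun_prop]
theorem computable_tripleAdd {α : Type*} [Primcodable α] {f g : α → ℕ × ℕ × ℕ} (hf : Computable f)
    (hg : Computable g) : Computable fun x => tripleAdd (f x) (g x) := by
  unfold tripleAdd
  fun_prop

@[fun_prop]
theorem computable_tripleNeg {α : Type*} [Primcodable α] {f : α → ℕ × ℕ × ℕ} (hf : Computable f) :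
    Computable fun x => tripleNeg (f x) := by
  unfold tripleNeg
  fun_prop

@[fun_prop]
theorem computable_tripleEq {α : Type*} [Primcodable α] {f g : α → ℕ × ℕ × ℕ} (hf : Computable f)
    (hg : Computable g) : Computable fun x => tripleEq (f x) (g x) := by
  unfold tripleEq
  fun_prop

section Copy

variable (v : ℕ × ℕ → ℕ × ℕ × ℕ) (e : ℕ)

/-- `i` is the first index of the rational number represented by `v (e, i)`. -/
def isFirst (i : ℕ) : Bool :=
  Nat.rec true (fun j r => r && !tripleEq (v (e, j)) (v (e, i))) i

theorem isFirst_iff (i : ℕ) :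
    isFirst v e i = true ↔ ∀ j < i, tripleRat (v (e, j)) ≠ tripleRat (v (e, i)) := by
  have h : ∀ k, Nat.rec (motive := fun _ => Bool) true
      (fun j r => r && !tripleEq (v (e, j)) (v (e, i))) k = true ↔
        ∀ j < k, tripleRat (v (e, j)) ≠ tripleRat (v (e, i)) := by
    intro k
    induction k with
    | zero => simp
    | succ k ih =>
      rw [Bool.and_eq_true, ih, Bool.not_eq_true', ← Bool.not_eq_true, tripleEq_iff,
        Nat.forall_lt_succ_right]
  exact h i

/-- One step of the evaluation of a term code, given the values at smaller codes. The Boolean tells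
whether the code is that of a term over the structure. -/
def evalStep (c : ℕ) (A B C : Bool × ℕ × ℕ × ℕ) : Bool × ℕ × ℕ × ℕ :=
  bif c % 3 == 1 then (isFirst v e (c / 3), v (e, c / 3)) else
  bif c % 3 == 2 then (A.1, tripleNeg A.2) else (B.1 && C.1, tripleAdd B.2 C.2)

/-- Evaluation of term codes. -/
def termValue : ℕ → Bool × ℕ × ℕ × ℕ
  | 0 => (true, 0, 0, 0)
  | c + 1 => evalStep v e (c + 1) (termValue ((c + 1) / 3)) (termValue ((c + 1) / 3 - 1).unpair.1)
      (termValue ((c + 1) / 3 - 1).unpair.2)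
  termination_by c => c
  decreasing_by
    · omega
    · have := Nat.unpair_left_le ((c + 1) / 3 - 1); omega
    · have := Nat.unpair_right_le ((c + 1) / 3 - 1); omega

variable {v}

theorem computable_isFirst (hv : Computable v) :
    Computable fun p : ℕ × ℕ => isFirst v p.1 p.2 := by
  have := Computable.fun_natRec (α := ℕ × ℕ) (f := fun p => p.2) (g := fun _ => true)
    (h := fun p => p.2.2 && !tripleEq (v (p.1.1, p.2.1)) (v (p.1.1, p.1.2)))
    (by fun_prop) (by fun_prop) (by fun_prop)
  exact this

theorem computable_termValue (hv : Computable v) :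
    Computable fun p : ℕ × ℕ => termValue v p.1 p.2 := by
  have hF := computable_isFirst hv
  have hF' : ∀ {α : Type} [Primcodable α] {f g : α → ℕ}, Computable f → Computable g →
      Computable fun x => isFirst v (f x) (g x) := fun hf hg =>
    hF.comp (g := fun x => (_, _)) (hf.pair hg)
  have h : Computable fun p : ℕ × List (Bool × ℕ × ℕ × ℕ) =>
      bif p.2.length == 0 then (true, 0, 0, 0) else
        evalStep v p.1 p.2.length ((p.2[p.2.length / 3]?).getD (false, 0, 0, 0))
          ((p.2[(p.2.length / 3 - 1).unpair.1]?).getD (false, 0, 0, 0))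
          ((p.2[(p.2.length / 3 - 1).unpair.2]?).getD (false, 0, 0, 0)) := by
    unfold evalStep
    refine Computable.fun_cond (by fun_prop) (by fun_prop) (Computable.fun_cond (by fun_prop)
      (Computable.fun_pair (hF' (by fun_prop) (by fun_prop)) (by fun_prop)) (by fun_prop))
  refine Computable.nat_strong_rec (fun e c => termValue v e c)
    (g := fun e l => some (bif l.length == 0 then (true, 0, 0, 0) else
        evalStep v e l.length ((l[l.length / 3]?).getD (false, 0, 0, 0))
          ((l[(l.length / 3 - 1).unpair.1]?).getD (false, 0, 0, 0))
          ((l[(l.length / 3 - 1).unpair.2]?).getD (false, 0, 0, 0))))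
    (Computable.option_some.comp h) fun e c => ?_
  congr 1
  have hl : ∀ m < c, (((List.range c).map (termValue v e))[m]?).getD (false, 0, 0, 0) =
      termValue v e m := by
    intro m hm
    simp [hm]
  rcases c with _ | c
  · simp [termValue]
  · rw [hl, hl, hl]
    · simp [termValue]
    · have := Nat.unpair_right_le ((c + 1) / 3 - 1); simp; omega
    · have := Nat.unpair_left_le ((c + 1) / 3 - 1); simp; omega
    · simp; omega

/-- The first indices of the rational numbers in the range. -/
def firstSet (v : ℕ × ℕ → ℕ × ℕ × ℕ) (e : ℕ) : Set ℕ := {i | isFirst v e i = true}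

theorem termValue_termCode {H : AddSubgroup ℚ} {w : firstSet v e → H}
    (hw : ∀ i, (w i : ℚ) = tripleRat (v (e, i))) (τ : grpLang.Term (firstSet v e)) :
    (termValue v e (termCode Subtype.val τ)).1 = true ∧
      tripleRat (termValue v e (termCode Subtype.val τ)).2 = (τ.realize w : H) := by
  induction τ with
  | var i =>
    have h₁ : (3 * i.1 + 1) % 3 = 1 := by omega
    have h₂ : (3 * i.1 + 1) / 3 = i.1 := by omega
    simp only [termCode, termValue, evalStep, h₁, h₂, beq_self_eq_true, cond_true]
    exact ⟨i.2, (hw i).symm⟩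
  | func f ts ih =>
    match f, ts, ih with
    | GrpFunc.e, ts, ih =>
      simp only [termCode, termValue]
      exact ⟨trivial, by simp [tripleRat]; rfl⟩
    | GrpFunc.inv, ts, ih =>
      have h₁ : (3 * termCode Subtype.val (ts 0) + 1 + 1) % 3 = 2 := by omega
      have h₂ : (3 * termCode Subtype.val (ts 0) + 1 + 1) / 3 = termCode Subtype.val (ts 0) := by
        omega
      simp only [termCode, termValue, evalStep, h₁, h₂]
      exact ⟨(ih 0).1, (tripleRat_neg _).trans (congrArg Neg.neg (ih 0).2)⟩
    | GrpFunc.op, ts, ih =>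
      set p := Nat.pair (termCode Subtype.val (ts 0)) (termCode Subtype.val (ts 1)) with hp
      have h₁ : (3 * p + 2 + 1) % 3 = 0 := by omega
      have h₂ : (3 * p + 2 + 1) / 3 - 1 = p := by omega
      simp only [termCode, ← hp, termValue, evalStep, h₁, h₂]
      rw [hp, Nat.unpair_pair]
      refine ⟨?_, (tripleRat_add _ _).trans (congrArg₂ (· + ·) (ih 0).2 (ih 1).2)⟩
      change (_ && _) = true
      rw [(ih 0).1, (ih 1).1]
      rfl

theorem exists_term_of_termValue (c : ℕ) (hc : (termValue v e c).1 = true) :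
    ∃ τ : grpLang.Term (firstSet v e), termCode Subtype.val τ = c := by
  induction c using Nat.strong_induction_on with
  | _ c ih =>
    rcases c with _ | c
    · exact ⟨tZero, termCode_tZero _⟩
    rw [termValue, evalStep] at hc
    have hl := Nat.unpair_left_le ((c + 1) / 3 - 1)
    have hr := Nat.unpair_right_le ((c + 1) / 3 - 1)
    obtain h | h | h : (c + 1) % 3 = 0 ∨ (c + 1) % 3 = 1 ∨ (c + 1) % 3 = 2 := by omega
    · rw [h] at hc
      have hc' := (Bool.and_eq_true _ _).mp hc
      obtain ⟨τ, hτ⟩ := ih _ (by omega) hc'.1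
      obtain ⟨σ, hσ⟩ := ih _ (by omega) hc'.2
      exact ⟨tAdd τ σ, by rw [termCode_tAdd, hτ, hσ, Nat.pair_unpair]; omega⟩
    · rw [h] at hc
      exact ⟨.var ⟨(c + 1) / 3, hc⟩, by simp only [termCode]; omega⟩
    · rw [h] at hc
      obtain ⟨τ, hτ⟩ := ih _ (by omega) hc
      exact ⟨tNeg τ, by rw [termCode_tNeg, hτ]; omega⟩

/-- The characteristic function of the atomic diagram. -/
def evalDiagram (v : ℕ × ℕ → ℕ × ℕ × ℕ) (e n : ℕ) : ℕ :=
  let s := termValue v e (n / 4).unpair.1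
  let t := termValue v e (n / 4).unpair.2
  bif s.1 && t.1 && (n % 4 == 0 && tripleEq s.2 t.2 || n % 4 == 1 && !tripleEq s.2 t.2) then 1 else 0

theorem computable_evalDiagram (hv : Computable v) :
    Computable fun p : ℕ × ℕ => evalDiagram v p.1 p.2 := by
  have hT : ∀ {f g : ℕ × ℕ → ℕ}, Computable f → Computable g →
      Computable fun x => termValue v (f x) (g x) := fun hf hg =>
    (computable_termValue hv).comp (g := fun x => (_, _)) (hf.pair hg)
  have h₁ : Computable fun p : ℕ × ℕ => termValue v p.1 (p.2 / 4).unpair.1 :=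
    hT (by fun_prop) (by fun_prop)
  have h₂ : Computable fun p : ℕ × ℕ => termValue v p.1 (p.2 / 4).unpair.2 :=
    hT (by fun_prop) (by fun_prop)
  unfold evalDiagram
  simp only
  exact Computable.fun_cond (Computable.fun_and (Computable.fun_and h₁.fun_fst h₂.fun_fst)
    (Computable.fun_or (Computable.fun_and (by fun_prop) (computable_tripleEq h₁.fun_snd h₂.fun_snd))
      (Computable.fun_and (by fun_prop)
        (Computable.fun_not (computable_tripleEq h₁.fun_snd h₂.fun_snd)))))
    (by fun_prop) (by fun_prop)

open Classical in
theorem exists_copy {H : AddSubgroup ℚ} (hH : ∀ r, r ∈ H ↔ ∃ i, tripleRat (v (e, i)) = r) :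
    ∃ (A : Set ℕ) (_ : grpLang.Structure A), GrpIso A H ∧
      ∀ n, evalDiagram v e n = if n ∈ atomicDiagram A then 1 else 0 := by
  let w : firstSet v e → H := fun i => ⟨tripleRat (v (e, i)), (hH _).2 ⟨i, rfl⟩⟩
  have hw : Function.Bijective w := by
    constructor
    · rintro ⟨i, hi⟩ ⟨j, hj⟩ h
      have h : tripleRat (v (e, i)) = tripleRat (v (e, j)) := congrArg Subtype.val h
      refine Subtype.ext ?_
      rcases lt_trichotomy i j with hij | hij | hij
      · exact absurd h ((isFirst_iff v e j).1 hj i hij)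
      · exact hij
      · exact absurd h.symm ((isFirst_iff v e i).1 hi j hij)
    · rintro ⟨r, hr⟩
      have h := (hH r).1 hr
      refine ⟨⟨Nat.find h, (isFirst_iff v e _).2 fun j hj hc => ?_⟩, Subtype.ext (Nat.find_spec h)⟩
      rw [Nat.find_spec h] at hc
      exact Nat.find_min h hj hc
  let E := (Equiv.ofBijective w hw).symm
  let S : grpLang.Structure (firstSet v e) := E.inducedStructure
  let I : FirstOrder.Language.Equiv grpLang (firstSet v e) H := E.inducedStructureEquiv.symm
  have hval : ∀ τ : grpLang.Term (firstSet v e),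
      tripleRat (termValue v e (termCode Subtype.val τ)).2 = I (τ.realize id) := by
    intro τ
    rw [← FirstOrder.Language.HomClass.realize_term]
    exact (termValue_termCode e (w := w) (fun i => rfl) τ).2
  have heq : ∀ σ τ : grpLang.Term (firstSet v e), tripleEq
      (termValue v e (termCode Subtype.val σ)).2 (termValue v e (termCode Subtype.val τ)).2 = true ↔
        (σ.realize id : firstSet v e) = τ.realize id := by
    intro σ τ
    rw [tripleEq_iff, hval, hval, Subtype.coe_inj, I.injective.eq_iff]
  have hterm := fun τ => (termValue_termCode e (w := w) (fun i => rfl) τ).1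
  refine ⟨firstSet v e, S, ⟨I⟩, fun n => ?_⟩
  have hmem : n ∈ atomicDiagram (firstSet v e) ↔ ((termValue v e (n / 4).unpair.1).1 &&
      (termValue v e (n / 4).unpair.2).1 && (n % 4 == 0 && tripleEq (termValue v e (n / 4).unpair.1).2
        (termValue v e (n / 4).unpair.2).2 || n % 4 == 1 && !tripleEq
          (termValue v e (n / 4).unpair.1).2 (termValue v e (n / 4).unpair.2).2)) = true := by
    simp only [Bool.and_eq_true, Bool.or_eq_true, beq_iff_eq, Bool.not_eq_true']
    constructor
    · rintro ⟨σ, τ, φ, rfl | rfl, h, rfl⟩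
      · have h₁ : (4 * Nat.pair (termCode Subtype.val σ) (termCode Subtype.val τ)) / 4 =
            Nat.pair (termCode Subtype.val σ) (termCode Subtype.val τ) := by omega
        simp only [QF.code, h₁, Nat.unpair_pair]
        exact ⟨⟨hterm σ, hterm τ⟩, Or.inl ⟨by omega, (heq σ τ).2 h⟩⟩
      · have h₁ : (4 * Nat.pair (termCode Subtype.val σ) (termCode Subtype.val τ) + 1) / 4 =
            Nat.pair (termCode Subtype.val σ) (termCode Subtype.val τ) := by omega
        simp only [QF.code, h₁, Nat.unpair_pair]
        refine ⟨⟨hterm σ, hterm τ⟩, Or.inr ⟨by omega, ?_⟩⟩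
        rw [← Bool.not_eq_true, heq]
        exact h
    · rintro ⟨⟨h₁, h₂⟩, h⟩
      obtain ⟨σ, hσ⟩ := exists_term_of_termValue e _ h₁
      obtain ⟨τ, hτ⟩ := exists_term_of_termValue e _ h₂
      have hn : n / 4 = Nat.pair (termCode Subtype.val σ) (termCode Subtype.val τ) := by
        rw [hσ, hτ, Nat.pair_unpair]
      rw [← hσ, ← hτ, ← Bool.not_eq_true, heq] at h
      rcases h with ⟨h₃, h⟩ | ⟨h₃, h⟩
      · exact ⟨σ, τ, _, Or.inl rfl, h, by rw [QF.code, ← hn]; omega⟩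
      · exact ⟨σ, τ, _, Or.inr rfl, h, by rw [QF.code, ← hn]; omega⟩
  rw [evalDiagram]
  split_ifs with h
  · rw [hmem] at h
    simp only [h, cond_true]
  · rw [hmem, Bool.not_eq_true] at h
    simp only [h, cond_false]

end Copy

/-! ## Completeness of the index set -/

theorem isMComplete_indexSet {G : AddSubgroup ℚ} {M : ℕ} {q : ℕ → ℕ} (hM : M ≠ 0)
    (hq : ∀ n, (q n).Prime ∧ q n ∣ M) (hq' : ∀ p, p.Prime → p ∣ M → ∃ n, q n = p)
    (hqc : Computable q) (hG : IsLoc M q G) : IsMComplete IsDSigma02 (indexSet G) := by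
  classical
  refine ⟨isDSigma02_indexSet hM hq hq' hqc hG, ?_⟩
  rintro _ ⟨S₁, S₂, h₁, h₂, rfl⟩
  obtain ⟨a, hac, ha, ha'⟩ := h₁.exists_counter
  obtain ⟨b, hbc, hb, hb'⟩ := h₂.exists_counter
  have hden : Computable fun p : ℕ × ℕ => stageDen M (a p.1 p.2) (b p.1 p.2) := by
    have h₃ := Computable.fun_natRec (α := ℕ × ℕ) (g := fun _ => 1) (h := fun p => p.2.2 * M) hac
      (by fun_prop) (by fun_prop)
    have h₄ := Computable.fun_natRec (α := ℕ × ℕ) (g := fun _ => 1)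
      (h := fun p => p.2.2 * (p.2.1 * M + 1)) hbc (by fun_prop) (by fun_prop)
    refine (Computable.fun_mul h₃ h₄).of_eq fun p => ?_
    rw [stageDen]
    congr 1
    · induction a p.1 p.2 with
      | zero => rfl
      | succ k ih => rw [pow_succ, ← ih]
    · induction b p.1 p.2 with
      | zero => rfl
      | succ k ih => rw [Finset.prod_range_succ, ← ih]
  let v : ℕ × ℕ → ℕ × ℕ × ℕ := fun p => (p.2.unpair.2.unpair.1, p.2.unpair.2.unpair.2,
    stageDen M (a p.1 p.2.unpair.1) (b p.1 p.2.unpair.1) - 1)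
  have hv : Computable v := by
    have : Computable fun p : ℕ × ℕ => stageDen M (a p.1 p.2.unpair.1) (b p.1 p.2.unpair.1) :=
      hden.comp (g := fun p : ℕ × ℕ => (p.1, p.2.unpair.1)) (by fun_prop)
    fun_prop
  let H : ℕ → AddSubgroup ℚ := fun e => unionGroup (fun s => stageDen M (a e s) (b e s))
    fun _ _ h => stageDen_dvd M (ha e h) (hb e h)
  have hH : ∀ e r, r ∈ H e ↔ ∃ i, tripleRat (v (e, i)) = r := by
    intro e r
    have hpos : ∀ s, (stageDen M (a e s) (b e s) : ℚ) ≠ 0 := fun s => by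
      exact_mod_cast (stageDen_pos hM _ _).ne'
    have hval : ∀ s p n, tripleRat (v (e, Nat.pair s (Nat.pair p n))) =
        ((p : ℚ) - n) / stageDen M (a e s) (b e s) := by
      intro s p n
      simp only [tripleRat, v, Nat.unpair_pair]
      congr 1
      exact_mod_cast Nat.sub_add_cancel (stageDen_pos hM _ _)
    constructor
    · rintro ⟨s, m, h⟩
      refine ⟨Nat.pair s (Nat.pair m.toNat (-m).toNat), ?_⟩
      rw [hval, div_eq_iff (hpos s)]
      refine Eq.trans ?_ h.symm
      exact_mod_cast Int.toNat_sub_toNat_neg m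
    · rintro ⟨i, rfl⟩
      obtain ⟨s, p, n, rfl⟩ : ∃ s p n, i = Nat.pair s (Nat.pair p n) :=
        ⟨i.unpair.1, i.unpair.2.unpair.1, i.unpair.2.unpair.2, by simp⟩
      refine ⟨s, p - n, ?_⟩
      rw [hval]
      push_cast
      exact div_mul_cancel₀ _ (hpos s)
  obtain ⟨f, hf, hf'⟩ := exists_phi_eq (f := fun e n => Part.some (evalDiagram v e n))
    (computable_evalDiagram hv)
  refine ⟨f, hf, fun e => ?_⟩
  obtain ⟨A, _, hA, hdiag⟩ := exists_copy e (hH e)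
  have hphi := phi_eq_indicator_iff.1 fun n => (congrFun (hf' e) n).trans
    (congrArg Part.some (hdiag n))
  have hG' := (G.compat.isLoc_iff M q).1 hG
  have h₅ : GrpIso A G ↔ IsLoc M q (H e) := by
    rw [(H e).compat.isLoc_iff]
    exact ⟨fun h => ⟨hG'.1.of_grpIso (h.symm.trans hA), hG'.2.of_grpIso (h.symm.trans hA)⟩,
      fun h => hA.trans (grpIso_of_sat hq hq' hM h hG')⟩
  change e ∈ S₁ \ S₂ ↔ f e ∈ indexSet G
  rw [mem_indexSet_iff hM hq hq' hG, hphi.2, ← grpIso_iff_diag hM hq hq' hG, h₅,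
    isLoc_unionGroup_iff hM hq (ha e) (hb e), ← ha', ← hb']
  exact ⟨fun h => ⟨hphi.1, isDiagram_atomicDiagram A, h⟩, fun h => h.2.2⟩

theorem mainTheorem6 (G : AddSubgroup ℚ) (hG : HasComputableCopy G)
    (u : G) (hu : u ≠ 0)
    (h0 : (P0 u).Finite) (hfin : (PFin u).Finite)
    (hinf : (PInf u).Infinite) (hne : PInf u ≠ {p : ℕ | p.Prime}) :
    (∃ φ : InfFormula 0, φ.IsComputableDSigma2 ∧ IsScottSentence φ G) ∧
      IsMComplete IsDSigma02 (indexSet G) := by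
  obtain ⟨M, q, hM, hq, hq', hqc, hL⟩ := exists_isLoc G u hu h0 hfin hne
  exact ⟨exists_scottSentence hM hq hq' hqc hL, isMComplete_indexSet hM hq hq' hqc hL⟩
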